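/- Let $G(x)=\frac1{4\pi|x|}$ on $\mathbb R^3$. For measurable $f$ on $\mathbb R^3$ and $p\ge1$ put $\|f\|_{L^{p,\infty}}=\sup_{t>0}t\,|\{|f|>t\}|^{1/p}$, and for $U\in C^1(\mathbb R^3)$ and $\alpha\in(0,1)$ put $\|U\|_{C^{1,\alpha}}=\sup|U|+\sup|\nabla U|+\sup_{x\ne y}\frac{|\nabla U(x)-\nabla U(y)|}{|x-y|^\alpha}$. **Proposition 2.6.** There are a universal constant $C>0$ and, for each $\alpha\in(0,1)$, a constant $C_\alpha>0$ depending only on $\alpha$ such that the following holds. Let $g\in L^1\cap L^\infty(\mathbb R^3)$ with $g\ge0$, let $\rho\in L^1\cap L^{5/3}(\mathbb R^3)$ be real-valued, and let $\bar U=G*\rho$. Then there exists $\widehat U\in C^1(\mathbb R^3)$ which satisfies $$\Delta\widehat U=g\,e^{\bar U+\widehat U}\quad\text{in the sense of distributions on }\mathbb R^3$$ and the estimates $$\|\widehat U\|_{L^{3,\infty}}\le C\,\|g\|_{L^1}\exp\Big\{C\,\|\rho\|_{L^1}^{1/6}\|\rho\|_{L^{5/3}}^{5/6}\Big\},$$ $$\|\nabla\widehat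 U\|_{L^{3/2,\infty}}\le C\,\|g\|_{L^1}\exp\Big\{C\,\|\rho\|_{L^1}^{1/6}\|\rho\|_{L^{5/3}}^{5/6}\Big\},$$ $$\|\widehat U\|_{C^{1,\alpha}}\le C_\alpha\,\big(\|g\|_{L^1}+\|g\|_{L^\infty}\big)\exp\Big\{C\,\|\rho\|_{L^1}^{1/6}\|\rho\|_{L^{5/3}}^{5/6}\Big\}\qquad\text{for all }\alpha\in(0,1).$$ In particular, for $g\neq0$, $\|\widehat U\|_{C^{1,\alpha}}\le C_{\alpha,g}\,\|g\|_{L^\infty}\exp\{C\|\rho\|_{L^1}^{1/6}\|\rho\|_{L^{5/3}}^{5/6}\}$ with $C_{\alpha,g}=C_\alpha\,(1+\|g\|_{L^1}/\|g\|_{L^\infty})$. -/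

import Mathlib

open MeasureTheory
open scoped ENNReal NNReal ContDiff Gradient Laplacian Convolution

/-- Three-dimensional Euclidean space, with Lebesgue measure `volume`. -/
abbrev R3 : Type := EuclideanSpace ℝ (Fin 3)

/-- The Green's function `G(x) = 1 / (4π|x|)` of `-Δ` on `ℝ³`. -/
noncomputable def greenKernel (x : R3) : ℝ := 1 / (4 * Real.pi * ‖x‖)

/-- The convolution `(G * ρ)(x) = ∫ G(y) ρ(x - y) dy`. -/
noncomputable def newtonPotential (ρ : R3 → ℝ) : R3 → ℝ :=
  greenKernel ⋆[ContinuousLinearMap.mul ℝ ℝ, volume] ρ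

/-- The weak Lebesgue (quasi-)norm `‖f‖_{L^{p,∞}} = sup_{t > 0} t |{x : |f x| > t}|^{1/p}`. -/
noncomputable def weakLpNorm {F : Type*} [NormedAddCommGroup F] (p : ℝ) (f : R3 → F) : ℝ≥0∞ :=
  ⨆ t : ℝ≥0, (t : ℝ≥0∞) * volume {x : R3 | (t : ℝ≥0∞) < ‖f x‖ₑ} ^ (1 / p)

/-- The norm `‖U‖_{C^{1,α}} = sup |U| + sup |∇U| + [∇U]_{C^{0,α}}`, for a `C¹` function `U`.
Values are in `[0, ∞]`. -/
noncomputable def c1HolderNorm (α : ℝ≥0) (U : R3 → ℝ) : ℝ≥0∞ :=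
  (⨆ x, ‖U x‖ₑ) + (⨆ x, ‖∇ U x‖ₑ) + eHolderNorm α (∇ U)

/-- `ΔU = f` on `ℝ³` in the sense of distributions. -/
def SolvesPoisson (U f : R3 → ℝ) : Prop :=
  LocallyIntegrable U volume ∧ LocallyIntegrable f volume ∧
    ∀ φ : R3 → ℝ, ContDiff ℝ ∞ φ → HasCompactSupport φ →
      ∫ x, U x * (Δ φ) x = ∫ x, f x * φ x

/-! The equation is solved in integral form, `U = -G * f` with `f = g e^{Ū + U}`. The kernel and the
density are nonnegative, so `U ≤ 0` and `e^U ≤ 1`. Hence `f ≤ g e^{Ū}` whatever `U` is, and the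
nonlinearity drops out of all the estimates: they become linear bounds on Newton potentials in terms
of `‖f‖₁` and `‖f‖_∞`.

The exponential factor comes from `|Ū| ≤ C₀ q` with `q = ‖ρ‖₁^{1/6} ‖ρ‖_{5/3}^{5/6}`
(`abs_newtonPotential_le`): split `1/|x|` at a radius `R`, use Hölder inside and `1/|x| ≤ 1/R`
outside, then balance the two parts. Thus `f ≤ e^{C₀ q} g` a.e.

Linear bounds: `G` and `∇G` are dominated by `|z|^{-1}` and `|z|^{-2}`. The weak-type bounds follow
by integrating the potential over a set `E` and estimating `∫_E |x - y|^{-s} dx` by a power of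
`|E|`. Differentiability and Hölder continuity of the gradient follow from kernel differences
dominated by `|z|^{-(2+α)}`, which is locally integrable exactly because `α < 1`.

Existence needs no smallness. Put `h = g e^{Ū}` and `μ = h dx`, a finite measure. On `L²(μ)` the
operator `A` with kernel `G(x - y)` is positive, as `G` is a mixture of Gaussians and each Gaussian
is a mixture of products. The truncated exponential `e^{min(u,0)}` is nondecreasing and 1-Lipschitz.
Subtracting its mean slope `1/2` turns `u = -A e^{min(u,0)}` into a fixed point problem for a strict
contraction (`exists_add_smul_eq_of_positive`). The solution is nonpositive, so the truncation is
inactive.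

That `U` solves the differential equation is the identity `G * Δφ = -φ` for test functions, combined
with Fubini. -/

/-! ### Riesz potentials: sup bounds and weak-type bounds. -/

section RieszPotential

/-- The Riesz kernel `‖z‖ ^ (-s)` with values in `[0, ∞]`. -/
noncomputable def rieszKernel (s : ℝ) (z : R3) : ℝ≥0∞ := ENNReal.ofReal (‖z‖ ^ (-s))

/-- The Riesz potential `∫ ‖x - y‖ ^ (-s) |f y| dy` of `|f|`, with values in `[0, ∞]`. -/
noncomputable def rieszPotential (s : ℝ) (f : R3 → ℝ) (x : R3) : ℝ≥0∞ :=
  ∫⁻ y, rieszKernel s (x - y) * ‖f y‖ₑ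

lemma measurable_rieszKernel (s : ℝ) : Measurable (rieszKernel s) := by
  unfold rieszKernel; fun_prop

lemma finrank_R3 : Module.finrank ℝ R3 = 3 := by simp [R3]

lemma volume_real_unitBall : (volume : Measure R3).real (Metric.ball 0 1) = Real.pi * 4 / 3 := by
  rw [Measure.real, EuclideanSpace.volume_ball_fin_three]
  simp; positivity

lemma lintegral_ball_rieszKernel {s : ℝ} (hs : s < 3) {R : ℝ} (hR : 0 < R) :
    ∫⁻ z in Metric.ball 0 R, rieszKernel s z
      = ENNReal.ofReal (4 * Real.pi / (3 - s) * R ^ (3 - s)) := by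
  have hint : IntegrableOn (fun z : R3 => ‖z‖ ^ (-s)) (Metric.ball 0 R) := by
    refine integrableOn_ball_of_norm_le_rpow (C := 1) (α := s) (by rw [finrank_R3]; norm_num)
      (by rw [finrank_R3]; exact_mod_cast hs) ?_ ?_
    · exact Filter.Eventually.of_forall fun x => by
        rw [Real.norm_of_nonneg (by positivity), one_mul]
    · exact (by fun_prop : Measurable fun z : R3 => ‖z‖ ^ (-s)).aestronglyMeasurable
  unfold rieszKernel
  rw [← ofReal_integral_eq_lintegral_ofReal hint
    (Filter.Eventually.of_forall fun x => by positivity)]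
  congr 1
  have h1 : ∫ z in Metric.ball (0 : R3) R, ‖z‖ ^ (-s)
      = ∫ z : R3, (Set.Iio R).indicator (fun r => r ^ (-s)) ‖z‖ := by
    rw [← integral_indicator measurableSet_ball]
    congr 1 with z
    simp [Set.indicator]
  rw [h1, integral_fun_norm_addHaar volume, finrank_R3, volume_real_unitBall]
  have h2 : ∫ y in Set.Ioi (0 : ℝ), y ^ (3 - 1) • (Set.Iio R).indicator (fun r => r ^ (-s)) y
      = ∫ y in (0 : ℝ)..R, y ^ (2 - s) := by
    rw [intervalIntegral.integral_of_le hR.le, ← integral_indicator measurableSet_Ioi,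
      integral_Ioc_eq_integral_Ioo, ← integral_indicator measurableSet_Ioo]
    congr 1 with y
    simp only [Set.indicator, Set.mem_Ioi, Set.mem_Iio, Set.mem_Ioo]
    by_cases hy : 0 < y <;> by_cases hy' : y < R <;> simp [hy, hy']
    rw [← Real.rpow_natCast, ← Real.rpow_add hy]
    norm_num
    ring_nf
  rw [h2, integral_rpow (Or.inl (by linarith)), Real.zero_rpow (by linarith)]
  simp only [nsmul_eq_mul, smul_eq_mul]
  have : 3 - s ≠ 0 := by linarith
  rw [show (2 - s + 1) = 3 - s by ring]
  field_simp
  push_cast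
  ring

lemma rieszKernel_le_indicator_add {s : ℝ} (hs : 0 ≤ s) {R : ℝ} (hR : 0 < R) (z : R3) :
    rieszKernel s z ≤ (Metric.ball 0 R).indicator (rieszKernel s) z + ENNReal.ofReal (R ^ (-s)) := by
  by_cases h : ‖z‖ < R
  · rw [Set.indicator_of_mem (by simpa using h)]
    exact le_self_add
  · rw [Set.indicator_of_notMem (by simpa using h), zero_add]
    exact ENNReal.ofReal_le_ofReal
      (Real.rpow_le_rpow_of_nonpos hR (not_lt.mp h) (by linarith))

lemma lintegral_indicator_rieszKernel_sub {s : ℝ} (hs : s < 3) {R : ℝ} (hR : 0 < R) (x : R3) :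
    ∫⁻ y, (Metric.ball 0 R).indicator (rieszKernel s) (x - y)
      = ENNReal.ofReal (4 * Real.pi / (3 - s) * R ^ (3 - s)) := by
  rw [lintegral_sub_left_eq_self ((Metric.ball 0 R).indicator (rieszKernel s)),
    lintegral_indicator measurableSet_ball, lintegral_ball_rieszKernel hs hR]

lemma rieszKernel_neg (s : ℝ) (z : R3) : rieszKernel s (-z) = rieszKernel s z := by
  simp [rieszKernel]

lemma rieszKernel_sub_comm (s : ℝ) (x y : R3) : rieszKernel s (x - y) = rieszKernel s (y - x) := by
  rw [← rieszKernel_neg, neg_sub]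

/-- Cut the kernel at radius 1: the inner part is integrable and pairs with the sup norm, and
outside the unit ball the kernel is at most 1. -/
lemma rieszPotential_le {s : ℝ} (hs : 0 ≤ s) (hs3 : s < 3) {f : R3 → ℝ}
    (hf : AEStronglyMeasurable f volume) (x : R3) :
    rieszPotential s f x
      ≤ ENNReal.ofReal (4 * Real.pi / (3 - s)) * eLpNorm f ∞ volume + eLpNorm f 1 volume := by
  calc rieszPotential s f x
      ≤ ∫⁻ y, ((Metric.ball 0 1).indicator (rieszKernel s) (x - y) * eLpNorm f ∞ volume
          + ‖f y‖ₑ) := by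
        refine lintegral_mono_ae ?_
        filter_upwards [enorm_ae_le_eLpNormEssSup f volume] with y hy
        calc rieszKernel s (x - y) * ‖f y‖ₑ
            ≤ ((Metric.ball 0 1).indicator (rieszKernel s) (x - y) + ENNReal.ofReal (1 ^ (-s)))
                * ‖f y‖ₑ := by
              gcongr; exact rieszKernel_le_indicator_add hs one_pos _
          _ ≤ _ := by
              rw [add_mul, Real.one_rpow, ENNReal.ofReal_one, one_mul, eLpNorm_exponent_top]
              gcongr
    _ = _ := by
        rw [lintegral_add_right' _ hf.enorm, lintegral_mul_const,
          lintegral_indicator_rieszKernel_sub hs3 one_pos, eLpNorm_one_eq_lintegral_enorm,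
          Real.one_rpow, mul_one]
        exact ((measurable_rieszKernel s).indicator measurableSet_ball).comp
          (measurable_const.sub measurable_id)

lemma rieszPotential_congr_ae {s : ℝ} {f g : R3 → ℝ} (h : f =ᵐ[volume] g) :
    rieszPotential s f = rieszPotential s g := by
  ext x
  refine lintegral_congr_ae ?_
  filter_upwards [h] with y hy
  rw [hy]

lemma measurable_rieszPotential (s : ℝ) {f : R3 → ℝ} (hf : AEStronglyMeasurable f volume) :
    Measurable (rieszPotential s f) := by
  rw [rieszPotential_congr_ae hf.ae_eq_mk]
  unfold rieszPotential
  refine Measurable.lintegral_prod_right' (f := fun p : R3 × R3 =>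
    rieszKernel s (p.1 - p.2) * ‖hf.mk f p.2‖ₑ) ?_
  have h1 := hf.stronglyMeasurable_mk.measurable
  have h2 := measurable_rieszKernel s
  fun_prop

/-- Among sets of given measure a ball about `y` is the worst, up to constants. Cutting at `R =
|E|^{1/3}` makes the near part `R^{3-s}` and the far part `R^{-s} |E|` the same power of `|E|`. -/
lemma setLIntegral_rieszKernel_le {s : ℝ} (hs : 0 ≤ s) (hs3 : s < 3) {E : Set R3}
    (hE0 : volume E ≠ 0) (hE : volume E ≠ ⊤) (y : R3) :
    ∫⁻ x in E, rieszKernel s (x - y)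
      ≤ ENNReal.ofReal (4 * Real.pi / (3 - s) + 1) * volume E ^ (1 - s / 3) := by
  set m : ℝ := (volume E).toReal with hm
  have hm0 : 0 < m := ENNReal.toReal_pos hE0 hE
  have hmE : volume E = ENNReal.ofReal m := (ENNReal.ofReal_toReal hE).symm
  set R : ℝ := m ^ (1 / 3 : ℝ) with hRdef
  have hR : 0 < R := by positivity
  have hR1 : R ^ (3 - s) = m ^ (1 - s / 3) := by
    rw [hRdef, ← Real.rpow_mul hm0.le]; congr 1; ring
  have hR2 : R ^ (-s) * m = m ^ (1 - s / 3) := by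
    rw [hRdef, ← Real.rpow_mul hm0.le]
    nth_rw 2 [← Real.rpow_one m]
    rw [← Real.rpow_add hm0]; congr 1; ring
  calc ∫⁻ x in E, rieszKernel s (x - y)
      ≤ ∫⁻ x in E, ((Metric.ball 0 R).indicator (rieszKernel s) (y - x)
          + ENNReal.ofReal (R ^ (-s))) := by
        refine lintegral_mono fun x => ?_
        rw [rieszKernel_sub_comm]
        exact rieszKernel_le_indicator_add hs hR _
    _ ≤ ENNReal.ofReal (4 * Real.pi / (3 - s) * R ^ (3 - s))
          + ENNReal.ofReal (R ^ (-s)) * volume E := by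
        rw [lintegral_add_right _ measurable_const, setLIntegral_const]
        gcongr
        exact (setLIntegral_le_lintegral _ _).trans
          (lintegral_indicator_rieszKernel_sub hs3 hR y).le
    _ = _ := by
        have h3 : 0 < 3 - s := by linarith
        rw [hmE, ← ENNReal.ofReal_mul (by positivity), ENNReal.ofReal_rpow_of_pos hm0,
          ← ENNReal.ofReal_mul (by positivity), ← ENNReal.ofReal_add (by positivity)
          (by positivity), hR1, hR2]
        congr 1; ring

/-- Chebyshev in dual form: by Tonelli the integral of the potential over `E` is at most `‖f‖₁`
times the bound on `∫_E |x - y|^{-s} dx`; a factor `|E|^{1-s/3}` is then cancelled, which requires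
`|E|` finite. -/
lemma mul_measure_rpow_le_of_lt_rieszPotential {s : ℝ} (hs : 0 < s) (hs3 : s < 3) {f : R3 → ℝ}
    (hf : AEStronglyMeasurable f volume) {t : ℝ≥0∞} {E : Set R3} (hE : volume E ≠ ⊤)
    (hmE : MeasurableSet E) (htE : ∀ x ∈ E, t ≤ rieszPotential s f x) :
    t * volume E ^ (s / 3)
      ≤ ENNReal.ofReal (4 * Real.pi / (3 - s) + 1) * eLpNorm f 1 volume := by
  by_cases hE0 : volume E = 0
  · rw [hE0, ENNReal.zero_rpow_of_pos (by positivity), mul_zero]; exact zero_le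
  have key : t * volume E ≤ ENNReal.ofReal (4 * Real.pi / (3 - s) + 1) * eLpNorm f 1 volume
      * volume E ^ (1 - s / 3) := by
    calc t * volume E = ∫⁻ _ in E, t := by rw [setLIntegral_const]
      _ ≤ ∫⁻ x in E, rieszPotential s f x := setLIntegral_mono' hmE htE
      _ = ∫⁻ y, ∫⁻ x in E, rieszKernel s (x - y) * ‖f y‖ₑ := by
          unfold rieszPotential
          rw [lintegral_lintegral_swap]
          have h2 := measurable_rieszKernel s
          refine AEMeasurable.mul
            (by fun_prop : Measurable fun p : R3 × R3 => rieszKernel s (p.1 - p.2)).aemeasurable ?_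
          exact hf.enorm.comp_quasiMeasurePreserving Measure.quasiMeasurePreserving_snd
      _ ≤ ∫⁻ y, ENNReal.ofReal (4 * Real.pi / (3 - s) + 1) * volume E ^ (1 - s / 3)
            * ‖f y‖ₑ := by
          refine lintegral_mono fun y => ?_
          rw [lintegral_mul_const _ (by have h2 := measurable_rieszKernel s; fun_prop)]
          gcongr
          exact setLIntegral_rieszKernel_le hs.le hs3 hE0 hE y
      _ = _ := by
          rw [lintegral_const_mul'' _ hf.enorm, eLpNorm_one_eq_lintegral_enorm]
          ring
  have hne : volume E ^ (1 - s / 3) ≠ 0 := by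
    simp [ENNReal.rpow_eq_zero_iff, hE0, hE]
  have hne' : volume E ^ (1 - s / 3) ≠ ⊤ :=
    ENNReal.rpow_ne_top_of_ne_zero hE0 hE
  rw [← ENNReal.mul_le_mul_iff_left hne hne', mul_assoc, ← ENNReal.rpow_add _ _ hE0 hE]
  simpa using key

lemma weakLpNorm_le_of_le_rieszPotential {F : Type*} [NormedAddCommGroup F] {s p : ℝ}
    (hs : 0 < s) (hs3 : s < 3) (hp : 1 / p = s / 3) {f : R3 → ℝ}
    (hf : AEStronglyMeasurable f volume) {U : R3 → F}
    (hU : ∀ x, ‖U x‖ₑ ≤ rieszPotential s f x) :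
    weakLpNorm p U ≤ ENNReal.ofReal (4 * Real.pi / (3 - s) + 1) * eLpNorm f 1 volume := by
  refine iSup_le fun t => ?_
  rw [hp]
  set E : Set R3 := {x | (t : ℝ≥0∞) < rieszPotential s f x} with hE
  have hEm : MeasurableSet E := measurableSet_lt measurable_const (measurable_rieszPotential s hf)
  have hsub : volume {x : R3 | (t : ℝ≥0∞) < ‖U x‖ₑ} ≤ volume E :=
    measure_mono fun x hx => lt_of_lt_of_le hx (hU x)
  refine (mul_le_mul_right (ENNReal.rpow_le_rpow hsub (by positivity)) _).trans ?_
  -- The superlevel set is not known to have finite measure in advance, so it is exhausted by its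
  -- intersections with balls.
  have hsup : volume E = ⨆ n : ℕ, volume (E ∩ Metric.ball 0 n) := by
    rw [← Monotone.measure_iUnion]
    · rw [← Set.inter_iUnion, Metric.iUnion_ball_nat, Set.inter_univ]
    · intro m n hmn
      exact Set.inter_subset_inter_right _ (Metric.ball_subset_ball (by exact_mod_cast hmn))
  have hiso := (ENNReal.orderIsoRpow (s / 3) (by positivity)).map_iSup
    (fun n : ℕ => volume (E ∩ Metric.ball 0 n))
  simp only [ENNReal.orderIsoRpow_apply] at hiso
  rw [hsup, hiso, ENNReal.mul_iSup]
  refine iSup_le fun n => ?_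
  refine mul_measure_rpow_le_of_lt_rieszPotential hs hs3 hf ?_ (hEm.inter measurableSet_ball)
    fun x hx => hx.1.le
  exact ((measure_mono Set.inter_subset_right).trans_lt
    (measure_ball_lt_top (μ := volume) (x := (0 : R3)) (r := n))).ne

end RieszPotential

/-! ### Pointwise Hölder and Taylor estimates for the kernels `x / |x|³` and `1 / |x|`. -/

section KernelInequalities

lemma inv_sq_le_rpow_mul {p h α : ℝ} (hp : 0 < p) (hα : 0 ≤ α) (hph : p ≤ h) :
    (p ^ 2)⁻¹ ≤ h ^ α * p ^ (-(2 + α)) := by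
  have h1 : (p ^ 2)⁻¹ = p ^ α * p ^ (-(2 + α)) := by
    rw [← Real.rpow_add hp, ← Real.rpow_natCast, ← Real.rpow_neg hp.le]
    congr 1; push_cast; ring
  rw [h1]
  gcongr

lemma mul_inv_cube_le_rpow_mul {p h α : ℝ} (hp : 0 < p) (hh : 0 ≤ h) (hα1 : α ≤ 1)
    (hph : h ≤ p) : h * (p ^ 3)⁻¹ ≤ h ^ α * p ^ (-(2 + α)) := by
  rcases hh.eq_or_lt with rfl | hh
  · rw [zero_mul]; positivity
  have h1 : (p ^ 3)⁻¹ = p ^ (α - 1) * p ^ (-(2 + α)) := by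
    rw [← Real.rpow_add hp, ← Real.rpow_natCast, ← Real.rpow_neg hp.le]
    congr 1; push_cast; ring
  have h2 : h ^ α = h * h ^ (α - 1) := by
    nth_rw 2 [← Real.rpow_one h]; rw [← Real.rpow_add hh]; congr 1; ring
  rw [h1, h2, mul_assoc]
  gcongr h * (?_ * _)
  exact Real.rpow_le_rpow_of_nonpos hh hph (by linarith)

variable {E : Type*} [NormedAddCommGroup E] [InnerProductSpace ℝ E]

/-- If `|a - b| ≥ |a|`, both terms are at most `|a|^{-2}` and no cancellation is needed. Otherwise a
mean value type bound `4 |a - b| |a|^{-3}` holds, and `|a - b| / |a| ≤ 1` may be raised to the power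
`α ≤ 1`. -/
lemma norm_inv_cube_smul_sub_le_of_norm_le {a b : E} (ha : a ≠ 0) {α : ℝ}
    (hα : 0 ≤ α) (hα1 : α ≤ 1) (hab : ‖a‖ ≤ ‖b‖) :
    ‖(‖a‖ ^ 3)⁻¹ • a - (‖b‖ ^ 3)⁻¹ • b‖ ≤ 4 * ‖a - b‖ ^ α * ‖a‖ ^ (-(2 + α)) := by
  have hp : 0 < ‖a‖ := norm_pos_iff.mpr ha
  have hq : 0 < ‖b‖ := hp.trans_le hab
  have hb : b ≠ 0 := norm_pos_iff.mp hq
  rcases le_total ‖a‖ ‖a - b‖ with h | h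
  · have hF : ∀ c : E, c ≠ 0 → ‖(‖c‖ ^ 3)⁻¹ • c‖ = (‖c‖ ^ 2)⁻¹ := fun c hc => by
      have := norm_ne_zero_iff.mpr hc
      rw [norm_smul, norm_inv, norm_pow, norm_norm]
      field_simp
    have h1 := inv_sq_le_rpow_mul hp hα h
    have h2 : (‖b‖ ^ 2)⁻¹ ≤ (‖a‖ ^ 2)⁻¹ := by gcongr
    have h3 := norm_sub_le ((‖a‖ ^ 3)⁻¹ • a) ((‖b‖ ^ 3)⁻¹ • b)
    rw [hF a ha, hF b hb] at h3
    have h4 : 0 ≤ ‖a - b‖ ^ α * ‖a‖ ^ (-(2 + α)) := by positivity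
    linarith
  · have h1 := mul_inv_cube_le_rpow_mul hp (norm_nonneg (a - b)) hα1 h
    have h2 : (‖a‖ ^ 3)⁻¹ • a - (‖b‖ ^ 3)⁻¹ • b
        = (‖b‖ ^ 3)⁻¹ • (a - b) + ((‖a‖ ^ 3)⁻¹ - (‖b‖ ^ 3)⁻¹) • a := by module
    have h3 : ‖b‖ - ‖a‖ ≤ ‖a - b‖ := by
      rw [norm_sub_rev]; exact norm_sub_norm_le b a
    have h5 : ((‖a‖ ^ 3)⁻¹ - (‖b‖ ^ 3)⁻¹) * ‖a‖ ≤ 3 * (‖a - b‖ * (‖a‖ ^ 3)⁻¹) := by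
      set p := ‖a‖
      set q := ‖b‖
      have e1 : ((p ^ 3)⁻¹ - (q ^ 3)⁻¹) * p
          = (q - p) * (q ^ 2 * (p ^ 2 * q ^ 3)⁻¹ + p * q * (p ^ 2 * q ^ 3)⁻¹
            + p ^ 2 * (p ^ 2 * q ^ 3)⁻¹) := by
        field_simp; ring
      have e2 : (p ^ 2 * q ^ 3)⁻¹ * q ^ 2 ≤ (p ^ 3)⁻¹ := by
        rw [inv_mul_le_iff₀ (by positivity), ← div_eq_mul_inv, le_div_iff₀ (by positivity)]
        nlinarith [mul_nonneg (by positivity : (0:ℝ) ≤ p ^ 2 * q ^ 2) (sub_nonneg.mpr hab)]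
      have e3 : p * q * (p ^ 2 * q ^ 3)⁻¹ ≤ q ^ 2 * (p ^ 2 * q ^ 3)⁻¹ := by
        gcongr; nlinarith
      have e4 : p ^ 2 * (p ^ 2 * q ^ 3)⁻¹ ≤ q ^ 2 * (p ^ 2 * q ^ 3)⁻¹ := by
        gcongr
      rw [e1]
      calc (q - p) * _ ≤ ‖a - b‖ * (3 * (p ^ 3)⁻¹) := by
            apply mul_le_mul h3 _ (by positivity) (norm_nonneg _)
            linarith
        _ = _ := by ring
    have h6 : (‖b‖ ^ 3)⁻¹ ≤ (‖a‖ ^ 3)⁻¹ := by gcongr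
    calc _ ≤ (‖b‖ ^ 3)⁻¹ * ‖a - b‖ + ((‖a‖ ^ 3)⁻¹ - (‖b‖ ^ 3)⁻¹) * ‖a‖ := by
          rw [h2]
          refine (norm_add_le _ _).trans (le_of_eq ?_)
          rw [norm_smul, norm_smul, Real.norm_of_nonneg (by positivity),
            Real.norm_of_nonneg (sub_nonneg.mpr h6)]
      _ ≤ (‖a‖ ^ 3)⁻¹ * ‖a - b‖ + 3 * (‖a - b‖ * (‖a‖ ^ 3)⁻¹) := by gcongr
      _ ≤ _ := by linarith

lemma norm_inv_cube_smul_sub_le {a b : E} (ha : a ≠ 0) (hb : b ≠ 0) {α : ℝ}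
    (hα : 0 ≤ α) (hα1 : α ≤ 1) :
    ‖(‖a‖ ^ 3)⁻¹ • a - (‖b‖ ^ 3)⁻¹ • b‖
      ≤ 4 * ‖a - b‖ ^ α * (‖a‖ ^ (-(2 + α)) + ‖b‖ ^ (-(2 + α))) := by
  rcases le_total ‖a‖ ‖b‖ with h | h
  · refine (norm_inv_cube_smul_sub_le_of_norm_le ha hα hα1 h).trans ?_
    gcongr
    exact le_add_of_nonneg_right (by positivity)
  · rw [norm_sub_rev, norm_sub_rev a b]
    refine (norm_inv_cube_smul_sub_le_of_norm_le hb hα hα1 h).trans ?_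
    gcongr
    exact le_add_of_nonneg_left (by positivity)

/-- The inner product is a polynomial in `|a|`, `|b|`, `|b - a|`, so the Taylor remainder has a
closed form in these lengths; `||b| - |a|| ≤ |b - a|` then bounds it. -/
lemma abs_inv_norm_sub_taylor_le_sq {a b : E} (ha : a ≠ 0) (hb : b ≠ 0) :
    |‖b‖⁻¹ - ‖a‖⁻¹ + (‖a‖ ^ 3)⁻¹ * inner ℝ a (b - a)|
      ≤ ‖b - a‖ ^ 2 * (‖a‖ ^ 3)⁻¹ + ‖b - a‖ ^ 2 * (‖a‖ ^ 2 * ‖b‖)⁻¹ := by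
  have hp : 0 < ‖a‖ := norm_pos_iff.mpr ha
  have hq : 0 < ‖b‖ := norm_pos_iff.mpr hb
  have hin : inner ℝ a (b - a) = (‖b‖ ^ 2 - ‖a‖ ^ 2 - ‖b - a‖ ^ 2) / 2 := by
    have h1 := norm_sub_sq_real b a
    rw [inner_sub_right, real_inner_self_eq_norm_sq, real_inner_comm]
    linarith
  have hqp : (‖b‖ - ‖a‖) ^ 2 ≤ ‖b - a‖ ^ 2 := by
    rw [← sq_abs]
    gcongr
    exact abs_norm_sub_norm_le b a
  rw [hin]
  set p := ‖a‖
  set q := ‖b‖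
  set h := ‖b - a‖
  have e : q⁻¹ - p⁻¹ + (p ^ 3)⁻¹ * ((q ^ 2 - p ^ 2 - h ^ 2) / 2)
      = (q - p) ^ 2 * ((q + 2 * p) / (2 * p ^ 3 * q)) - h ^ 2 * (2 * p ^ 3)⁻¹ := by
    field_simp; ring
  have e2 : (q + 2 * p) / (2 * p ^ 3 * q) = (2 * p ^ 3)⁻¹ + (p ^ 2 * q)⁻¹ := by
    field_simp
  have e3 : (p ^ 3)⁻¹ = (2 * p ^ 3)⁻¹ + (2 * p ^ 3)⁻¹ := by field_simp; norm_num
  have e4 : (q - p) ^ 2 * ((2 * p ^ 3)⁻¹ + (p ^ 2 * q)⁻¹)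
      ≤ h ^ 2 * ((2 * p ^ 3)⁻¹ + (p ^ 2 * q)⁻¹) := by gcongr
  have e5 : 0 ≤ (q - p) ^ 2 * ((2 * p ^ 3)⁻¹ + (p ^ 2 * q)⁻¹) := by positivity
  have e6 : 0 ≤ h ^ 2 * (2 * p ^ 3)⁻¹ := by positivity
  have e7 : 0 ≤ h ^ 2 * (p ^ 2 * q)⁻¹ := by positivity
  rw [e, e2, e3, abs_le]
  constructor <;> nlinarith

lemma abs_inv_norm_sub_taylor_le {a b : E} (ha : a ≠ 0) (hb : b ≠ 0) {α : ℝ}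
    (hα : 0 ≤ α) (hα1 : α ≤ 1) :
    |‖b‖⁻¹ - ‖a‖⁻¹ + (‖a‖ ^ 3)⁻¹ * inner ℝ a (b - a)|
      ≤ 4 * (‖b - a‖ * ‖b - a‖ ^ α) * (‖a‖ ^ (-(2 + α)) + ‖b‖ ^ (-(2 + α))) := by
  have hp : 0 < ‖a‖ := norm_pos_iff.mpr ha
  have hq : 0 < ‖b‖ := norm_pos_iff.mpr hb
  have hh : 0 ≤ ‖b - a‖ := norm_nonneg _
  have hinv : ∀ r : ℝ, 0 < r → r⁻¹ = r * (r ^ 2)⁻¹ := fun r hr => by field_simp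
  rcases le_total ‖b - a‖ ‖a‖ with hhp | hph
  · refine (abs_inv_norm_sub_taylor_le_sq ha hb).trans ?_
    set p := ‖a‖
    set q := ‖b‖
    set h := ‖b - a‖
    have hP : 0 ≤ p ^ (-(2 + α)) := by positivity
    have hQ : 0 ≤ q ^ (-(2 + α)) := by positivity
    have hH : 0 ≤ h ^ α := by positivity
    have h1 := mul_le_mul_of_nonneg_left (mul_inv_cube_le_rpow_mul hp hh hα1 hhp) hh
    -- This part of the remainder is singular at `b = 0` too. For `h ≤ q` it is shared between `p⁻³`
    -- and `q⁻³`; for `q ≤ h ≤ p` it is at most `q⁻¹ ≤ h q⁻²`.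
    have h2 : h ^ 2 * (p ^ 2 * q)⁻¹
        ≤ (h * h ^ α) * (p ^ (-(2 + α)) + q ^ (-(2 + α))) := by
      rcases le_total h q with hhq | hqh
      · have h3 := mul_le_mul_of_nonneg_left (mul_inv_cube_le_rpow_mul hq hh hα1 hhq) hh
        have h4 : (p ^ 2 * q)⁻¹ ≤ (p ^ 3)⁻¹ + (q ^ 3)⁻¹ := by
          rcases le_total p q with hpq | hqp
          · have : (p ^ 2 * q)⁻¹ ≤ (p ^ 3)⁻¹ := by
              rw [show p ^ 3 = p ^ 2 * p by ring]; gcongr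
            exact this.trans (le_add_of_nonneg_right (by positivity))
          · have : (p ^ 2 * q)⁻¹ ≤ (q ^ 3)⁻¹ := by
              rw [show q ^ 3 = q ^ 2 * q by ring]; gcongr
            exact this.trans (le_add_of_nonneg_left (by positivity))
        calc h ^ 2 * (p ^ 2 * q)⁻¹ ≤ h ^ 2 * ((p ^ 3)⁻¹ + (q ^ 3)⁻¹) := by gcongr
          _ ≤ _ := by linarith
      · have h3 := inv_sq_le_rpow_mul hq hα hqh
        have h4 : h ^ 2 * (p ^ 2 * q)⁻¹ ≤ h * (q ^ 2)⁻¹ := by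
          calc h ^ 2 * (p ^ 2 * q)⁻¹ ≤ p ^ 2 * (p ^ 2 * q)⁻¹ := by gcongr
            _ = q * (q ^ 2)⁻¹ := by field_simp
            _ ≤ _ := by gcongr
        calc _ ≤ h * (q ^ 2)⁻¹ := h4
          _ ≤ h * (h ^ α * q ^ (-(2 + α))) := by gcongr
          _ = (h * h ^ α) * q ^ (-(2 + α)) := by ring
          _ ≤ _ := by gcongr; exact le_add_of_nonneg_left hP
    have h5 : 0 ≤ h * h ^ α * p ^ (-(2 + α)) := by positivity
    have h6 : 0 ≤ h * h ^ α * q ^ (-(2 + α)) := by positivity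
    nlinarith
  -- When `|b - a| ≥ |a|` the Taylor cancellation is useless and the three terms are bounded one by
  -- one.
  · have hq2 : ‖b‖ ≤ 2 * ‖b - a‖ := by
      have := norm_le_norm_add_norm_sub a b
      rw [norm_sub_rev] at this; linarith
    have hCS : |inner ℝ a (b - a)| ≤ ‖a‖ * ‖b - a‖ := abs_real_inner_le_norm _ _
    have hlhs : |‖b‖⁻¹ - ‖a‖⁻¹ + (‖a‖ ^ 3)⁻¹ * inner ℝ a (b - a)|
        ≤ ‖b‖⁻¹ + ‖a‖⁻¹ + ‖b - a‖ * (‖a‖ ^ 2)⁻¹ := by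
      have h1 : |(‖a‖ ^ 3)⁻¹ * inner ℝ a (b - a)| ≤ ‖b - a‖ * (‖a‖ ^ 2)⁻¹ := by
        rw [abs_mul, abs_of_pos (by positivity)]
        calc _ ≤ (‖a‖ ^ 3)⁻¹ * (‖a‖ * ‖b - a‖) := by gcongr
          _ = _ := by field_simp
      have h2 : 0 < ‖b‖⁻¹ := by positivity
      have h3 : 0 < ‖a‖⁻¹ := by positivity
      rw [abs_le] at h1 ⊢
      constructor <;> linarith
    refine hlhs.trans ?_
    set p := ‖a‖
    set q := ‖b‖
    set h := ‖b - a‖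
    have hP : 0 ≤ p ^ (-(2 + α)) := by positivity
    have hQ : 0 ≤ q ^ (-(2 + α)) := by positivity
    have h1 := mul_le_mul_of_nonneg_left (inv_sq_le_rpow_mul hp hα hph) hh
    have h2 : p⁻¹ ≤ h * (p ^ 2)⁻¹ := by rw [hinv p hp]; gcongr
    have h3 : q⁻¹ ≤ 4 * (h * (h ^ α * q ^ (-(2 + α)))) := by
      have h4 : (2 * h) ^ α ≤ 2 * h ^ α := by
        rw [Real.mul_rpow (by norm_num) hh]
        gcongr
        calc (2 : ℝ) ^ α ≤ 2 ^ (1 : ℝ) := by gcongr; norm_num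
          _ = 2 := Real.rpow_one 2
      calc q⁻¹ = q * (q ^ 2)⁻¹ := hinv q hq
        _ ≤ (2 * h) * ((2 * h) ^ α * q ^ (-(2 + α))) := by
            gcongr; exact inv_sq_le_rpow_mul hq hα hq2
        _ ≤ (2 * h) * ((2 * h ^ α) * q ^ (-(2 + α))) := by gcongr
        _ = _ := by ring
    have h5 : 0 ≤ h * (h ^ α * p ^ (-(2 + α))) := by positivity
    nlinarith

end KernelInequalities

/-! ### Regularity of Newton potentials of densities in `L¹ ∩ L^∞`. -/

section NewtonPotential

/-- The gradient `-x / (4π|x|³)` of the Green's function. -/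
noncomputable def gradGreenKernel (x : R3) : R3 := -((4 * Real.pi)⁻¹ • (‖x‖ ^ 3)⁻¹ • x)

/-- The vector-valued potential `∫ f(y) ∇G(x - y) dy`. -/
noncomputable def gradNewtonPotential (f : R3 → ℝ) (x : R3) : R3 :=
  ∫ y, f y • gradGreenKernel (x - y)

lemma newtonPotential_apply (f : R3 → ℝ) (x : R3) :
    newtonPotential f x = ∫ y, f y * greenKernel (x - y) := by
  rw [newtonPotential, ← convolution_flip]
  simp [convolution_def]

lemma greenKernel_eq (z : R3) : greenKernel z = (4 * Real.pi)⁻¹ * ‖z‖⁻¹ := by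
  rw [greenKernel, one_div, mul_inv]

lemma measurable_greenKernel : Measurable greenKernel := by
  unfold greenKernel; fun_prop

lemma measurable_gradGreenKernel : Measurable gradGreenKernel := by
  unfold gradGreenKernel; fun_prop

lemma greenKernel_nonneg (z : R3) : 0 ≤ greenKernel z := by
  unfold greenKernel; positivity

lemma four_mul_four_pi_inv_le_one : 4 * (4 * Real.pi)⁻¹ ≤ 1 := by
  rw [mul_inv_le_iff₀ (by positivity)]
  linarith [Real.pi_gt_three]

lemma four_pi_inv_le_one : (4 * Real.pi)⁻¹ ≤ 1 := by
  have : 0 ≤ (4 * Real.pi)⁻¹ := by positivity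
  linarith [four_mul_four_pi_inv_le_one]

lemma enorm_greenKernel_le (z : R3) : ‖greenKernel z‖ₑ ≤ rieszKernel 1 z := by
  rw [← ofReal_norm, Real.norm_of_nonneg (greenKernel_nonneg z)]
  refine ENNReal.ofReal_le_ofReal ?_
  rw [greenKernel_eq, Real.rpow_neg_one]
  exact mul_le_of_le_one_left (by positivity) four_pi_inv_le_one

lemma enorm_gradGreenKernel_le (z : R3) : ‖gradGreenKernel z‖ₑ ≤ rieszKernel 2 z := by
  rw [← ofReal_norm]
  refine ENNReal.ofReal_le_ofReal ?_
  rw [gradGreenKernel, norm_neg, norm_smul, norm_smul, Real.norm_of_nonneg (by positivity),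
    Real.norm_of_nonneg (by positivity)]
  refine (mul_le_of_le_one_left (by positivity) four_pi_inv_le_one).trans ?_
  rw [Real.rpow_neg (norm_nonneg _), Real.rpow_ofNat]
  by_cases hz : ‖z‖ = 0
  · simp [hz]
  · exact le_of_eq (by field_simp)

/-- The sum of the `L¹` and `L^∞` norms. -/
noncomputable def l1AddLinfty (f : R3 → ℝ) : ℝ :=
  (eLpNorm f 1 volume).toReal + (eLpNorm f ⊤ volume).toReal

variable {f : R3 → ℝ}

lemma rieszPotential_le_ofReal (h1 : MemLp f 1 volume) (hi : MemLp f ⊤ volume) {s : ℝ}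
    (hs : 0 ≤ s) (hs3 : s < 3) (x : R3) :
    rieszPotential s f x ≤ ENNReal.ofReal ((4 * Real.pi / (3 - s) + 1) * l1AddLinfty f) := by
  refine (rieszPotential_le hs hs3 h1.1 x).trans ?_
  have h3 : 0 < 3 - s := by linarith
  rw [← ENNReal.ofReal_toReal h1.2.ne, ← ENNReal.ofReal_toReal hi.2.ne,
    ← ENNReal.ofReal_mul (by positivity), ← ENNReal.ofReal_add (by positivity) (by positivity)]
  refine ENNReal.ofReal_le_ofReal ?_
  unfold l1AddLinfty
  have h4 : 0 ≤ 4 * Real.pi / (3 - s) := by positivity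
  nlinarith [mul_nonneg h4 (ENNReal.toReal_nonneg (a := eLpNorm f 1 volume)),
    ENNReal.toReal_nonneg (a := eLpNorm f ⊤ volume)]

lemma integrable_smul_kernel_sub {E : Type*} [NormedAddCommGroup E] [NormedSpace ℝ E]
    [MeasurableSpace E] [BorelSpace E] [SecondCountableTopology E]
    {k : R3 → E} (hk : Measurable k) {s : ℝ} (hks : ∀ z, ‖k z‖ₑ ≤ rieszKernel s z)
    (hf : AEStronglyMeasurable f volume) {x : R3} (hx : rieszPotential s f x < ⊤) :
    Integrable (fun y => f y • k (x - y)) := by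
  refine ⟨hf.smul (hk.comp (measurable_const.sub measurable_id)).aestronglyMeasurable, ?_⟩
  refine lt_of_le_of_lt (lintegral_mono fun y => ?_) hx
  rw [enorm_smul, mul_comm]
  gcongr
  exact hks _

lemma enorm_integral_smul_kernel_sub_le {E : Type*} [NormedAddCommGroup E] [NormedSpace ℝ E]
    {k : R3 → E} {s : ℝ} (hks : ∀ z, ‖k z‖ₑ ≤ rieszKernel s z) (x : R3) :
    ‖∫ y, f y • k (x - y)‖ₑ ≤ rieszPotential s f x := by
  refine (enorm_integral_le_lintegral_enorm _).trans (lintegral_mono fun y => ?_)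
  rw [enorm_smul, mul_comm]
  gcongr
  exact hks _

lemma enorm_newtonPotential_le (x : R3) : ‖newtonPotential f x‖ₑ ≤ rieszPotential 1 f x := by
  rw [newtonPotential_apply]
  exact enorm_integral_smul_kernel_sub_le enorm_greenKernel_le x

lemma enorm_gradNewtonPotential_le (x : R3) :
    ‖gradNewtonPotential f x‖ₑ ≤ rieszPotential 2 f x :=
  enorm_integral_smul_kernel_sub_le enorm_gradGreenKernel_le x

lemma integrable_mul_greenKernel (h1 : MemLp f 1 volume) (hi : MemLp f ⊤ volume) (x : R3) :
    Integrable fun y => f y * greenKernel (x - y) :=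
  integrable_smul_kernel_sub measurable_greenKernel enorm_greenKernel_le h1.1
    ((rieszPotential_le_ofReal h1 hi zero_le_one (by norm_num) x).trans_lt ENNReal.ofReal_lt_top)

lemma integrable_smul_gradGreenKernel (h1 : MemLp f 1 volume) (hi : MemLp f ⊤ volume) (x : R3) :
    Integrable fun y => f y • gradGreenKernel (x - y) :=
  integrable_smul_kernel_sub measurable_gradGreenKernel enorm_gradGreenKernel_le h1.1
    ((rieszPotential_le_ofReal h1 hi zero_le_two (by norm_num) x).trans_lt ENNReal.ofReal_lt_top)

lemma ae_sub_ne_zero (x : R3) : ∀ᵐ y : R3, x - y ≠ 0 := by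
  filter_upwards [compl_mem_ae_iff.mpr (measure_singleton (μ := volume) x)] with y hy
  exact sub_ne_zero.mpr (Ne.symm hy)

/-- The kernel difference costs `|x - x'|^α` times two Riesz kernels of order `2 + α < 3`, whose
potentials are bounded; the constant `4` of the kernel inequality is absorbed by `1/(4π)`. -/
lemma enorm_gradNewtonPotential_sub_le (h1 : MemLp f 1 volume) (hi : MemLp f ⊤ volume)
    {α : ℝ} (hα : 0 ≤ α) (hα1 : α < 1) (x x' : R3) :
    ‖gradNewtonPotential f x - gradNewtonPotential f x'‖ₑ ≤
      ENNReal.ofReal (2 * (4 * Real.pi / (1 - α) + 1) * l1AddLinfty f * ‖x - x'‖ ^ α) := by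
  have hker : ∀ᵐ y : R3, ‖f y • gradGreenKernel (x - y) - f y • gradGreenKernel (x' - y)‖ₑ
      ≤ ENNReal.ofReal (‖x - x'‖ ^ α) *
        (rieszKernel (2 + α) (x - y) * ‖f y‖ₑ + rieszKernel (2 + α) (x' - y) * ‖f y‖ₑ) := by
    filter_upwards [ae_sub_ne_zero x, ae_sub_ne_zero x'] with y hy hy'
    rw [← smul_sub, enorm_smul, ← add_mul, ← mul_assoc, mul_comm]
    gcongr
    unfold rieszKernel
    rw [← ENNReal.ofReal_add (by positivity) (by positivity), ← ENNReal.ofReal_mul (by positivity),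
      ← ofReal_norm]
    refine ENNReal.ofReal_le_ofReal ?_
    have h := norm_inv_cube_smul_sub_le hy hy' hα hα1.le
    rw [sub_sub_sub_cancel_right] at h
    have e : gradGreenKernel (x - y) - gradGreenKernel (x' - y) = -((4 * Real.pi)⁻¹ •
        ((‖x - y‖ ^ 3)⁻¹ • (x - y) - (‖x' - y‖ ^ 3)⁻¹ • (x' - y))) := by
      unfold gradGreenKernel; module
    rw [e, norm_neg, norm_smul, Real.norm_of_nonneg (by positivity)]
    have hpos : 0 ≤ ‖x - x'‖ ^ α * (‖x - y‖ ^ (-(2 + α)) + ‖x' - y‖ ^ (-(2 + α))) := by positivity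
    calc _ ≤ (4 * Real.pi)⁻¹ * (4 * ‖x - x'‖ ^ α *
          (‖x - y‖ ^ (-(2 + α)) + ‖x' - y‖ ^ (-(2 + α)))) := by gcongr
      _ = (4 * (4 * Real.pi)⁻¹) * (‖x - x'‖ ^ α *
          (‖x - y‖ ^ (-(2 + α)) + ‖x' - y‖ ^ (-(2 + α)))) := by ring
      _ ≤ _ := mul_le_of_le_one_left hpos four_mul_four_pi_inv_le_one
  have hα3 : 3 - (2 + α) = 1 - α := by ring
  have hI := fun z => rieszPotential_le_ofReal h1 hi (by positivity : 0 ≤ 2 + α) (by linarith) z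
  rw [hα3] at hI
  have hD : 0 ≤ l1AddLinfty f := by unfold l1AddLinfty; positivity
  have h1α : 0 < 1 - α := by linarith
  have hk := measurable_rieszKernel (2 + α)
  rw [gradNewtonPotential, gradNewtonPotential,
    ← integral_sub (integrable_smul_gradGreenKernel h1 hi x)
      (integrable_smul_gradGreenKernel h1 hi x')]
  refine (enorm_integral_le_lintegral_enorm _).trans ((lintegral_mono_ae hker).trans ?_)
  rw [lintegral_const_mul' _ _ ENNReal.ofReal_ne_top, lintegral_add_left' (by
    exact (hk.comp (measurable_const.sub measurable_id)).aemeasurable.mul h1.1.enorm)]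
  refine (mul_le_mul_right (add_le_add (hI x) (hI x')) _).trans ?_
  rw [← ENNReal.ofReal_add (by positivity) (by positivity), ← ENNReal.ofReal_mul (by positivity)]
  exact ENNReal.ofReal_le_ofReal (le_of_eq (by ring))

/-- The Taylor bound for the kernel is integrated with Hölder exponent `1/2`. Any exponent in `(0,
1)` would do: the remainder must be `o(|x' - x|)` while the kernel order, here `5/2`, stays below 3.
-/
lemma norm_newtonPotential_sub_taylor_le (h1 : MemLp f 1 volume) (hi : MemLp f ⊤ volume)
    (x x' : R3) :
    ‖newtonPotential f x' - newtonPotential f x - inner ℝ (gradNewtonPotential f x) (x' - x)‖ ≤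
      2 * (8 * Real.pi + 1) * l1AddLinfty f * (‖x' - x‖ * ‖x' - x‖ ^ (1 / 2 : ℝ)) := by
  set h : ℝ := ‖x' - x‖ * ‖x' - x‖ ^ (1 / 2 : ℝ) with hh
  have hh0 : 0 ≤ h := by positivity
  have hker : ∀ᵐ y : R3, ‖f y * greenKernel (x' - y) - f y * greenKernel (x - y)
        - inner ℝ (f y • gradGreenKernel (x - y)) (x' - x)‖ₑ
      ≤ ENNReal.ofReal h *
        (rieszKernel (5 / 2) (x - y) * ‖f y‖ₑ + rieszKernel (5 / 2) (x' - y) * ‖f y‖ₑ) := by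
    filter_upwards [ae_sub_ne_zero x, ae_sub_ne_zero x'] with y hy hy'
    have e : f y * greenKernel (x' - y) - f y * greenKernel (x - y)
        - inner ℝ (f y • gradGreenKernel (x - y)) (x' - x)
        = f y * ((4 * Real.pi)⁻¹ * (‖x' - y‖⁻¹ - ‖x - y‖⁻¹
          + (‖x - y‖ ^ 3)⁻¹ * inner ℝ (x - y) (x' - x))) := by
      simp only [greenKernel_eq, gradGreenKernel, inner_smul_left, inner_neg_left,
        RCLike.conj_to_real]
      ring
    rw [e, enorm_mul, ← add_mul, ← mul_assoc, mul_comm]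
    gcongr
    unfold rieszKernel
    rw [← ENNReal.ofReal_add (by positivity) (by positivity), ← ENNReal.ofReal_mul (by positivity),
      ← ofReal_norm]
    refine ENNReal.ofReal_le_ofReal ?_
    have h := abs_inv_norm_sub_taylor_le hy hy' (α := 1 / 2) (by norm_num) (by norm_num)
    rw [sub_sub_sub_cancel_right, ← hh, show (2 : ℝ) + 1 / 2 = 5 / 2 by norm_num] at h
    rw [norm_mul, Real.norm_of_nonneg (by positivity), Real.norm_eq_abs]
    calc _ ≤ (4 * Real.pi)⁻¹ * _ := mul_le_mul_of_nonneg_left h (by positivity)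
      _ = (4 * (4 * Real.pi)⁻¹) * _ := by ring
      _ ≤ _ := mul_le_of_le_one_left (by positivity) four_mul_four_pi_inv_le_one
  have hI := fun z => rieszPotential_le_ofReal h1 hi (s := 5 / 2) (by norm_num) (by norm_num) z
  rw [show 4 * Real.pi / (3 - 5 / 2) = 8 * Real.pi by ring] at hI
  have hD : 0 ≤ l1AddLinfty f := by unfold l1AddLinfty; positivity
  have hk := measurable_rieszKernel (5 / 2)
  have hint := integrable_smul_gradGreenKernel h1 hi x
  have hsub : Integrable fun y => f y * greenKernel (x' - y) - f y * greenKernel (x - y) :=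
    (integrable_mul_greenKernel h1 hi x').sub (integrable_mul_greenKernel h1 hi x)
  rw [newtonPotential_apply, newtonPotential_apply, gradNewtonPotential, real_inner_comm,
    ← integral_inner hint, ← integral_sub (integrable_mul_greenKernel h1 hi x')
      (integrable_mul_greenKernel h1 hi x), ← integral_sub hsub (hint.const_inner _)]
  rw [← ENNReal.ofReal_le_ofReal_iff (by positivity), ofReal_norm]
  simp_rw [real_inner_comm _ (x' - x)]
  refine (enorm_integral_le_lintegral_enorm _).trans ((lintegral_mono_ae hker).trans ?_)
  rw [lintegral_const_mul' _ _ ENNReal.ofReal_ne_top, lintegral_add_left' (by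
    exact (hk.comp (measurable_const.sub measurable_id)).aemeasurable.mul h1.1.enorm)]
  refine (mul_le_mul_right (add_le_add (hI x) (hI x')) _).trans ?_
  rw [← ENNReal.ofReal_add (by positivity) (by positivity), ← ENNReal.ofReal_mul (by positivity)]
  exact ENNReal.ofReal_le_ofReal (le_of_eq (by ring))

lemma hasGradientAt_newtonPotential (h1 : MemLp f 1 volume) (hi : MemLp f ⊤ volume) (x : R3) :
    HasGradientAt (newtonPotential f) (gradNewtonPotential f x) x := by
  rw [hasGradientAt_iff_isLittleO]
  have hO : (fun x' => newtonPotential f x' - newtonPotential f x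
      - inner ℝ (gradNewtonPotential f x) (x' - x)) =O[nhds x]
      fun x' => ‖x' - x‖ * ‖x' - x‖ ^ (1 / 2 : ℝ) :=
    Asymptotics.IsBigO.of_bound _ (Filter.Eventually.of_forall fun x' => by
      rw [Real.norm_of_nonneg (by positivity : 0 ≤ ‖x' - x‖ * ‖x' - x‖ ^ (1 / 2 : ℝ))]
      exact norm_newtonPotential_sub_taylor_le h1 hi x x')
  refine hO.trans_isLittleO ?_
  have hlim : Filter.Tendsto (fun x' : R3 => ‖x' - x‖ ^ (1 / 2 : ℝ)) (nhds x) (nhds 0) := by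
    have : Continuous fun x' : R3 => ‖x' - x‖ ^ (1 / 2 : ℝ) :=
      (continuous_id.sub continuous_const).norm.rpow_const fun _ => Or.inr (by norm_num)
    simpa using this.tendsto x
  have h2 := (Asymptotics.isBigO_refl (fun x' : R3 => ‖x' - x‖) (nhds x)).mul_isLittleO
    ((Asymptotics.isLittleO_one_iff ℝ).mpr hlim)
  simp only [mul_one] at h2
  exact h2.trans_isBigO (Asymptotics.isBigO_norm_left.mpr (Asymptotics.isBigO_refl _ _))

lemma gradient_newtonPotential (h1 : MemLp f 1 volume) (hi : MemLp f ⊤ volume) :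
    ∇ (newtonPotential f) = gradNewtonPotential f :=
  funext fun x => (hasGradientAt_newtonPotential h1 hi x).gradient

lemma holderWith_gradNewtonPotential (h1 : MemLp f 1 volume) (hi : MemLp f ⊤ volume)
    {α : ℝ≥0} (hα1 : α < 1) :
    HolderWith (2 * (4 * Real.pi / (1 - α) + 1) * l1AddLinfty f).toNNReal α
      (gradNewtonPotential f) := by
  intro x x'
  have hα1' : (0 : ℝ) < 1 - α := sub_pos.mpr (by exact_mod_cast hα1)
  have hD : 0 ≤ l1AddLinfty f := by unfold l1AddLinfty; positivity
  have h := enorm_gradNewtonPotential_sub_le h1 hi α.coe_nonneg (by exact_mod_cast hα1) x x'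
  rw [edist_eq_enorm_sub, edist_eq_enorm_sub]
  refine h.trans (le_of_eq ?_)
  rw [ENNReal.ofReal_mul (by positivity), ← ofReal_norm (x - x'),
    ENNReal.ofReal_rpow_of_nonneg (norm_nonneg _) α.coe_nonneg]
  rfl

lemma contDiff_newtonPotential (h1 : MemLp f 1 volume) (hi : MemLp f ⊤ volume) :
    ContDiff ℝ 1 (newtonPotential f) := by
  rw [contDiff_one_iff_fderiv]
  refine ⟨fun x => (hasGradientAt_newtonPotential h1 hi x).differentiableAt, ?_⟩
  have h2 : fderiv ℝ (newtonPotential f)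
      = fun x => InnerProductSpace.toDual ℝ R3 (gradNewtonPotential f x) :=
    funext fun x => (hasGradientAt_newtonPotential h1 hi x).hasFDerivAt.fderiv
  rw [h2]
  have h3 : Continuous (gradNewtonPotential f) :=
    (holderWith_gradNewtonPotential h1 hi (α := 1 / 2) (by
      rw [← NNReal.coe_lt_coe]; norm_num)).continuous (by norm_num)
  fun_prop

lemma c1HolderNorm_newtonPotential_le (h1 : MemLp f 1 volume) (hi : MemLp f ⊤ volume)
    {α : ℝ≥0} (hα1 : α < 1) :
    c1HolderNorm α (newtonPotential f) ≤ ENNReal.ofReal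
      ((8 * Real.pi / (1 - α) + 6 * Real.pi + 4) * l1AddLinfty f) := by
  have hα1' : (0 : ℝ) < 1 - α := sub_pos.mpr (by exact_mod_cast hα1)
  have hD : 0 ≤ l1AddLinfty f := by unfold l1AddLinfty; positivity
  unfold c1HolderNorm
  rw [gradient_newtonPotential h1 hi]
  have e1 : ⨆ x, ‖newtonPotential f x‖ₑ
      ≤ ENNReal.ofReal ((4 * Real.pi / (3 - 1) + 1) * l1AddLinfty f) := iSup_le fun x =>
    (enorm_newtonPotential_le x).trans
      (rieszPotential_le_ofReal h1 hi zero_le_one (by norm_num) x)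
  have e2 : ⨆ x, ‖gradNewtonPotential f x‖ₑ
      ≤ ENNReal.ofReal ((4 * Real.pi / (3 - 2) + 1) * l1AddLinfty f) := iSup_le fun x =>
    (enorm_gradNewtonPotential_le x).trans
      (rieszPotential_le_ofReal h1 hi zero_le_two (by norm_num) x)
  have e3 := (holderWith_gradNewtonPotential h1 hi hα1).eHolderNorm_le
  refine (add_le_add (add_le_add e1 e2) e3).trans ?_
  -- The three bounds have constants `2π + 1`, `4π + 1` and `2(4π/(1 - α) + 1)`.
  change _ + _ + ENNReal.ofReal _ ≤ _
  norm_num only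
  rw [← ENNReal.ofReal_add (by positivity) (by positivity),
    ← ENNReal.ofReal_add (by positivity) (by positivity)]
  exact ENNReal.ofReal_le_ofReal (le_of_eq (by ring))

end NewtonPotential

/-! ### The fundamental solution of the Laplacian. -/

section FundamentalSolution

lemma laplacian_eq_sum_fderiv {φ : R3 → ℝ} (hφ : ContDiff ℝ 2 φ) (x : R3) :
    (Δ φ) x = ∑ i, fderiv ℝ (fun y => fderiv ℝ φ y (EuclideanSpace.basisFun (Fin 3) ℝ i)) x
      (EuclideanSpace.basisFun (Fin 3) ℝ i) := by
  rw [InnerProductSpace.laplacian_eq_iteratedFDeriv_orthonormalBasis φ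
    (EuclideanSpace.basisFun (Fin 3) ℝ)]
  refine Finset.sum_congr rfl fun i _ => ?_
  have hd : DifferentiableAt ℝ (fderiv ℝ φ) x :=
    ((hφ.fderiv_right (m := 1) (by norm_num)).differentiable (by norm_num)) x
  rw [iteratedFDeriv_two_apply, fderiv_clm_apply hd (differentiableAt_const _)]
  simp

lemma contDiff_fderiv_apply {φ : R3 → ℝ} {n : WithTop ℕ∞} (hφ : ContDiff ℝ (n + 1) φ) (v : R3) :
    ContDiff ℝ n fun y => fderiv ℝ φ y v :=
  (hφ.fderiv_right le_rfl).clm_apply contDiff_const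

lemma continuous_laplacian {φ : R3 → ℝ} (hφ : ContDiff ℝ 2 φ) : Continuous (Δ φ) := by
  rw [funext (laplacian_eq_sum_fderiv hφ)]
  refine continuous_finsetSum _ fun i _ => ?_
  exact (contDiff_fderiv_apply (n := 0)
    (contDiff_fderiv_apply (n := 1) (by exact_mod_cast hφ) _) _).continuous

lemma hasCompactSupport_laplacian {φ : R3 → ℝ} (hc : HasCompactSupport φ) :
    HasCompactSupport (Δ φ) := by
  refine hc.mono' fun x hx => ?_
  by_contra hx'
  refine hx ?_
  have h0 : φ =ᶠ[nhds x] fun _ => 0 := notMem_tsupport_iff_eventuallyEq.mp hx'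
  rw [(InnerProductSpace.laplacian_congr_nhds h0).eq_of_nhds]
  simp

/-- Two integrations by parts in each coordinate. Only `φ` has compact support, which already makes
every product integrable. -/
lemma integral_mul_laplacian_eq {u φ : R3 → ℝ} (hu : ContDiff ℝ 2 u) (hφ : ContDiff ℝ 2 φ)
    (hc : HasCompactSupport φ) : ∫ x, u x * (Δ φ) x = ∫ x, (Δ u) x * φ x := by
  simp_rw [laplacian_eq_sum_fderiv hφ, laplacian_eq_sum_fderiv hu, Finset.mul_sum, Finset.sum_mul]
  have key : ∀ i : Fin 3, ∀ e : R3, e = EuclideanSpace.basisFun (Fin 3) ℝ i →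
      Integrable (fun x => u x * fderiv ℝ (fun y => fderiv ℝ φ y e) x e) ∧
      Integrable (fun x => fderiv ℝ (fun y => fderiv ℝ u y e) x e * φ x) ∧
      ∫ x, u x * fderiv ℝ (fun y => fderiv ℝ φ y e) x e
        = ∫ x, fderiv ℝ (fun y => fderiv ℝ u y e) x e * φ x := by
    intro i e _
    have hu1 : ContDiff ℝ 1 fun y => fderiv ℝ u y e :=
      contDiff_fderiv_apply (by exact_mod_cast hu) _
    have hφ1 : ContDiff ℝ 1 fun y => fderiv ℝ φ y e :=
      contDiff_fderiv_apply (by exact_mod_cast hφ) _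
    have hu2 : Continuous fun x => fderiv ℝ (fun y => fderiv ℝ u y e) x e :=
      (contDiff_fderiv_apply (n := 0) (by exact_mod_cast hu1) _).continuous
    have hφ2 : Continuous fun x => fderiv ℝ (fun y => fderiv ℝ φ y e) x e :=
      (contDiff_fderiv_apply (n := 0) (by exact_mod_cast hφ1) _).continuous
    have hc1 : HasCompactSupport fun y => fderiv ℝ φ y e := hc.fderiv_apply ℝ e
    have hc2 : HasCompactSupport fun x => fderiv ℝ (fun y => fderiv ℝ φ y e) x e :=
      hc1.fderiv_apply ℝ e
    have i1 : Integrable fun x => u x * fderiv ℝ (fun y => fderiv ℝ φ y e) x e :=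
      (hu.continuous.mul hφ2).integrable_of_hasCompactSupport hc2.mul_left
    have i2 : Integrable fun x => fderiv ℝ u x e * fderiv ℝ φ x e :=
      (hu1.continuous.mul hφ1.continuous).integrable_of_hasCompactSupport hc1.mul_left
    have i3 : Integrable fun x => fderiv ℝ (fun y => fderiv ℝ u y e) x e * φ x :=
      (hu2.mul hφ.continuous).integrable_of_hasCompactSupport hc.mul_left
    have i4 : Integrable fun x => u x * fderiv ℝ φ x e :=
      (hu.continuous.mul hφ1.continuous).integrable_of_hasCompactSupport hc1.mul_left
    have i5 : Integrable fun x => fderiv ℝ u x e * φ x :=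
      (hu1.continuous.mul hφ.continuous).integrable_of_hasCompactSupport hc.mul_left
    refine ⟨i1, i3, ?_⟩
    rw [integral_mul_fderiv_eq_neg_fderiv_mul_of_integrable i2 i1 i4
        (fun x _ => hu.differentiable (by norm_num) x)
        (fun x _ => hφ1.differentiable (by norm_num) x),
      integral_mul_fderiv_eq_neg_fderiv_mul_of_integrable i3 i2 i5
        (fun x _ => hu1.differentiable (by norm_num) x)
        (fun x _ => hφ.differentiable (by norm_num) x), neg_neg]
  rw [integral_finsetSum _ fun i _ => (key i _ rfl).1,
    integral_finsetSum _ fun i _ => (key i _ rfl).2.1]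
  exact Finset.sum_congr rfl fun i _ => (key i _ rfl).2.2

lemma hasFDerivAt_add_norm_sq_rpow {δ : ℝ} (hδ : 0 < δ) (r : ℝ) (x : R3) :
    HasFDerivAt (fun y : R3 => (δ + ‖y‖ ^ 2) ^ r)
      ((r * (δ + ‖x‖ ^ 2) ^ (r - 1)) • (2 • innerSL ℝ x)) x := by
  have h1 : HasFDerivAt (fun y : R3 => δ + ‖y‖ ^ 2) (2 • innerSL ℝ x) x :=
    (hasStrictFDerivAt_norm_sq x).hasFDerivAt.const_add δ
  exact h1.rpow_const (Or.inl (by positivity))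

lemma contDiff_add_norm_sq_rpow {δ : ℝ} (hδ : 0 < δ) (r : ℝ) :
    ContDiff ℝ 2 fun y : R3 => (δ + ‖y‖ ^ 2) ^ r :=
  (contDiff_const.add (contDiff_norm_sq ℝ)).rpow_const_of_ne fun y => by positivity

/-- With `Q = δ + |x|²`, summing the second derivatives gives `3 |x|² Q^{-5/2} - 3 Q^{-3/2}`, and
`|x|² - Q = -δ`. The result is an approximate identity up to the factor `-4π`. -/
lemma laplacian_add_norm_sq_rpow {δ : ℝ} (hδ : 0 < δ) (x : R3) :
    (Δ fun y : R3 => (δ + ‖y‖ ^ 2) ^ (-(1 / 2) : ℝ)) x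
      = -(3 * δ * (δ + ‖x‖ ^ 2) ^ (-(5 / 2) : ℝ)) := by
  have hQ : 0 < δ + ‖x‖ ^ 2 := by positivity
  rw [laplacian_eq_sum_fderiv (contDiff_add_norm_sq_rpow hδ _)]
  have h : ∀ e : R3, fderiv ℝ (fun y => fderiv ℝ (fun y : R3 => (δ + ‖y‖ ^ 2) ^ (-(1 / 2) : ℝ)) y e)
      x e = 3 * (δ + ‖x‖ ^ 2) ^ (-(5 / 2) : ℝ) * inner ℝ x e ^ 2
        - (δ + ‖x‖ ^ 2) ^ (-(3 / 2) : ℝ) * ‖e‖ ^ 2 := by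
    intro e
    have h1 : (fun y => fderiv ℝ (fun y : R3 => (δ + ‖y‖ ^ 2) ^ (-(1 / 2) : ℝ)) y e)
        = fun y => -((δ + ‖y‖ ^ 2) ^ (-(3 / 2) : ℝ) * innerSL ℝ e y) := by
      ext y
      rw [(hasFDerivAt_add_norm_sq_rpow hδ _ y).fderiv]
      simp only [smul_apply, innerSL_apply_apply, smul_eq_mul, nsmul_eq_mul]
      rw [real_inner_comm]
      norm_num
      ring
    rw [h1, (((hasFDerivAt_add_norm_sq_rpow hδ (-(3 / 2)) x).fun_mul
      (innerSL ℝ e).hasFDerivAt).fun_neg).fderiv]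
    simp only [neg_apply, add_apply,
      smul_apply, innerSL_apply_apply, smul_eq_mul, nsmul_eq_mul,
      real_inner_self_eq_norm_sq]
    rw [real_inner_comm e x]
    norm_num
    ring
  simp_rw [h]
  rw [Finset.sum_sub_distrib, ← Finset.mul_sum, OrthonormalBasis.sum_sq_inner_left]
  simp only [OrthonormalBasis.norm_eq_one, one_pow, mul_one, Finset.sum_const, Finset.card_univ,
    Fintype.card_fin]
  have h2 : (δ + ‖x‖ ^ 2) ^ (-(3 / 2) : ℝ)
      = (δ + ‖x‖ ^ 2) * (δ + ‖x‖ ^ 2) ^ (-(5 / 2) : ℝ) := by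
    rw [← Real.rpow_one_add' hQ.le (by norm_num)]; norm_num
  rw [h2]
  simp only [nsmul_eq_mul]
  push_cast
  ring

/-- A smooth probability density with the decay of the Laplacian of `(1 + |x|²) ^ (-1/2)`. -/
noncomputable def laplacianBump (x : R3) : ℝ :=
  3 / (4 * Real.pi) * (1 + ‖x‖ ^ 2) ^ (-(5 / 2) : ℝ)

lemma integral_laplacianBump : ∫ x, laplacianBump x = 1 := by
  -- In polar coordinates the integrand has the explicit primitive `r³ (1 + r²)^{-3/2}`, which tends
  -- to 1.
  have hderiv : ∀ r : ℝ, HasDerivAt (fun r : ℝ => r ^ 3 * (1 + r ^ 2) ^ (-(3 / 2) : ℝ))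
      (3 * (r ^ 2 * (1 + r ^ 2) ^ (-(5 / 2) : ℝ))) r := by
    intro r
    have hQ : 0 < 1 + r ^ 2 := by positivity
    have h1 : HasDerivAt (fun r : ℝ => 1 + r ^ 2) (2 * r) r := by
      simpa using (hasDerivAt_pow 2 r).const_add 1
    have h2 := (hasDerivAt_pow 3 r).mul (h1.rpow_const (p := -(3 / 2)) (Or.inl hQ.ne'))
    refine h2.congr_deriv ?_
    have h3 : (1 + r ^ 2) ^ (-(3 / 2) : ℝ) = (1 + r ^ 2) * (1 + r ^ 2) ^ (-(5 / 2) : ℝ) := by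
      rw [← Real.rpow_one_add' hQ.le (by norm_num)]; norm_num
    rw [h3]
    norm_num
    ring
  have hlim : Filter.Tendsto (fun r : ℝ => r ^ 3 * (1 + r ^ 2) ^ (-(3 / 2) : ℝ)) Filter.atTop
      (nhds 1) := by
    have h1 : Filter.Tendsto (fun r : ℝ => (1 + (r ^ 2)⁻¹) ^ (-(3 / 2) : ℝ)) Filter.atTop
        (nhds 1) := by
      have h2 : Filter.Tendsto (fun r : ℝ => 1 + (r ^ 2)⁻¹) Filter.atTop (nhds (1 + 0)) :=
        (tendsto_inv_atTop_zero.comp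
          (Filter.tendsto_pow_atTop (by norm_num))).const_add 1
      rw [add_zero] at h2
      simpa using h2.rpow_const (p := -(3 / 2)) (Or.inl one_ne_zero)
    refine h1.congr' ?_
    filter_upwards [Filter.eventually_gt_atTop 0] with r hr
    have e : 1 + r ^ 2 = r ^ 2 * (1 + (r ^ 2)⁻¹) := by field_simp; ring
    rw [e, Real.mul_rpow (by positivity) (by positivity), ← mul_assoc]
    have e2 : r ^ 3 * (r ^ 2) ^ (-(3 / 2) : ℝ) = 1 := by
      rw [← Real.rpow_natCast_mul hr.le, ← Real.rpow_natCast r 3, ← Real.rpow_add hr]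
      norm_num
    rw [e2, one_mul]
  have hI := integral_Ioi_of_hasDerivAt_of_nonneg' (a := 0) (fun r _ => hderiv r)
    (fun r _ => by positivity) hlim
  unfold laplacianBump
  rw [integral_fun_norm_addHaar volume
    (fun r : ℝ => 3 / (4 * Real.pi) * (1 + r ^ 2) ^ (-(5 / 2) : ℝ)), finrank_R3,
    volume_real_unitBall]
  have e : ∀ y : ℝ, y ^ (3 - 1) • (3 / (4 * Real.pi) * (1 + y ^ 2) ^ (-(5 / 2) : ℝ))
      = (4 * Real.pi)⁻¹ * (3 * (y ^ 2 * (1 + y ^ 2) ^ (-(5 / 2) : ℝ))) := fun y => by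
    simp only [smul_eq_mul]; ring
  simp_rw [e]
  rw [integral_const_mul, hI]
  simp only [nsmul_eq_mul, smul_eq_mul]
  push_cast
  field_simp
  norm_num

lemma tendsto_norm_pow_mul_laplacianBump :
    Filter.Tendsto (fun x : R3 => ‖x‖ ^ 3 * laplacianBump x) (Bornology.cobounded R3)
      (nhds 0) := by
  have h1 : Filter.Tendsto (fun x : R3 => 3 / (4 * Real.pi) * (‖x‖ ^ 2)⁻¹)
      (Bornology.cobounded R3) (nhds 0) := by
    have h2 : Filter.Tendsto (fun x : R3 => (‖x‖ ^ 2)⁻¹) (Bornology.cobounded R3) (nhds 0) :=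
      (tendsto_inv_atTop_zero.comp (Filter.tendsto_pow_atTop (by norm_num))).comp
        tendsto_norm_cobounded_atTop
    simpa using h2.const_mul (3 / (4 * Real.pi))
  refine squeeze_zero' (Filter.Eventually.of_forall fun x => by unfold laplacianBump; positivity)
    ?_ h1
  filter_upwards [tendsto_norm_cobounded_atTop.eventually (Filter.eventually_gt_atTop 0)] with x hx
  unfold laplacianBump
  have h3 : (1 + ‖x‖ ^ 2) ^ (-(5 / 2) : ℝ) ≤ (‖x‖ ^ 2) ^ (-(5 / 2) : ℝ) :=
    Real.rpow_le_rpow_of_nonpos (by positivity) (by linarith) (by norm_num)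
  have h4 : (‖x‖ ^ 2) ^ (-(5 / 2) : ℝ) = (‖x‖ ^ 5)⁻¹ := by
    rw [← Real.rpow_natCast_mul hx.le, ← Real.rpow_natCast ‖x‖ 5, ← Real.rpow_neg hx.le]
    norm_num
  rw [h4] at h3
  calc ‖x‖ ^ 3 * (3 / (4 * Real.pi) * (1 + ‖x‖ ^ 2) ^ (-(5 / 2) : ℝ))
      ≤ ‖x‖ ^ 3 * (3 / (4 * Real.pi) * (‖x‖ ^ 5)⁻¹) := by gcongr
    _ = _ := by field_simp

/-- Regularise `1/|x|` to `(c⁻² + |x|²)^{-1/2}`, which is smooth, and compute the limit `c → ∞` of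
its pairing with `Δφ` in two ways. -/
lemma integral_laplacian_mul_inv_norm {φ : R3 → ℝ} (hφ : ContDiff ℝ 2 φ)
    (hc : HasCompactSupport φ) :
    ∫ x, ‖x‖⁻¹ * (Δ φ) x = -(4 * Real.pi) * φ 0 := by
  have hΔ := continuous_laplacian hφ
  have hΔc := hasCompactSupport_laplacian hc
  have hint : Integrable fun x => ‖x‖⁻¹ * (Δ φ) x := by
    have h := (integrable_mul_greenKernel (hΔ.memLp_of_hasCompactSupport hΔc)
      (hΔ.memLp_of_hasCompactSupport hΔc) 0).const_mul (4 * Real.pi)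
    refine h.congr (Filter.Eventually.of_forall fun x => ?_)
    simp only [zero_sub, greenKernel_eq, norm_neg]
    field_simp
  -- Dominated convergence: the regularised kernel lies below `1/|x|`.
  have hleft : Filter.Tendsto
      (fun c : ℝ => ∫ x, (c⁻¹ ^ 2 + ‖x‖ ^ 2) ^ (-(1 / 2) : ℝ) * (Δ φ) x) Filter.atTop
      (nhds (∫ x, ‖x‖⁻¹ * (Δ φ) x)) := by
    have e0 : ∀ x : R3, (‖x‖ ^ 2) ^ (-(1 / 2) : ℝ) = ‖x‖⁻¹ := fun x => by
      rw [← Real.rpow_natCast_mul (norm_nonneg x)]; norm_num [Real.rpow_neg_one]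
    have hne : ∀ᵐ x : R3, x ≠ 0 := compl_mem_ae_iff.mpr (measure_singleton (0 : R3))
    refine tendsto_integral_filter_of_dominated_convergence (fun x => ‖‖x‖⁻¹ * (Δ φ) x‖) ?_ ?_
      hint.norm ?_
    · filter_upwards [Filter.eventually_gt_atTop 0] with c hc0
      exact ((contDiff_add_norm_sq_rpow (by positivity) _).continuous.mul hΔ).aestronglyMeasurable
    · filter_upwards with c
      filter_upwards [hne] with x hx
      have hx0 : 0 < ‖x‖ := norm_pos_iff.mpr hx
      rw [norm_mul, norm_mul]
      gcongr
      rw [Real.norm_of_nonneg (by positivity), Real.norm_of_nonneg (by positivity), ← e0]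
      exact Real.rpow_le_rpow_of_nonpos (by positivity)
        (le_add_of_nonneg_left (by positivity)) (by norm_num)
    · filter_upwards [hne] with x hx
      have hx0 : 0 < ‖x‖ := norm_pos_iff.mpr hx
      refine Filter.Tendsto.mul_const _ ?_
      have h1 : Filter.Tendsto (fun c : ℝ => c⁻¹ ^ 2 + ‖x‖ ^ 2) Filter.atTop
          (nhds (0 ^ 2 + ‖x‖ ^ 2)) := (tendsto_inv_atTop_zero.pow 2).add_const _
      rw [zero_pow (by norm_num), zero_add] at h1
      rw [← e0]
      exact h1.rpow_const (Or.inl (by positivity))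
  -- After integration by parts the Laplacian of the regularised kernel is `-4π c³ laplacianBump (c
  -- x)`, an approximate identity at the origin.
  have hright : Filter.Tendsto
      (fun c : ℝ => ∫ x, (c⁻¹ ^ 2 + ‖x‖ ^ 2) ^ (-(1 / 2) : ℝ) * (Δ φ) x) Filter.atTop
      (nhds (-(4 * Real.pi) * φ 0)) := by
    have h1 := tendsto_integral_comp_smul_smul_of_integrable (μ := (volume : Measure R3))
      (fun x => by unfold laplacianBump; positivity) integral_laplacianBump
      (by rw [finrank_R3]; exact tendsto_norm_pow_mul_laplacianBump)
      (hφ.continuous.integrable_of_hasCompactSupport hc) hφ.continuous.continuousAt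
    refine (h1.const_mul (-(4 * Real.pi))).congr' ?_
    filter_upwards [Filter.eventually_gt_atTop 0] with c hc0
    rw [integral_mul_laplacian_eq (contDiff_add_norm_sq_rpow (by positivity) _) hφ hc,
      ← integral_const_mul]
    congr 1 with x
    rw [laplacian_add_norm_sq_rpow (by positivity), finrank_R3, laplacianBump, smul_eq_mul,
      norm_smul, Real.norm_of_nonneg hc0.le]
    have e : 1 + (c * ‖x‖) ^ 2 = c ^ 2 * (c⁻¹ ^ 2 + ‖x‖ ^ 2) := by field_simp
    have e2 : (c ^ 2) ^ (-(5 / 2) : ℝ) = (c ^ 5)⁻¹ := by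
      rw [← Real.rpow_natCast_mul hc0.le, ← Real.rpow_natCast c 5, ← Real.rpow_neg hc0.le]
      norm_num
    rw [e, Real.mul_rpow (by positivity) (by positivity), e2]
    field_simp
  exact tendsto_nhds_unique hleft hright

/-- `-G` is a fundamental solution of the Laplacian. -/
theorem newtonPotential_laplacian {φ : R3 → ℝ} (hφ : ContDiff ℝ 2 φ)
    (hc : HasCompactSupport φ) (x : R3) : newtonPotential (Δ φ) x = -φ x := by
  have hψ : ContDiff ℝ 2 fun y => φ (y + x) := hφ.comp (contDiff_id.add contDiff_const)
  have hψc : HasCompactSupport fun y => φ (y + x) :=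
    hc.comp_homeomorph (Homeomorph.addRight x)
  have h := integral_laplacian_mul_inv_norm hψ hψc
  have hΔ : ∀ y, (Δ fun y => φ (y + x)) y = (Δ φ) (y + x) := fun y => by
    simp only [InnerProductSpace.laplacian_eq_iteratedFDeriv_stdOrthonormalBasis,
      iteratedFDeriv_comp_add_right]
  simp_rw [hΔ, zero_add] at h
  rw [newtonPotential_apply, ← integral_add_right_eq_self _ x]
  have e : ∀ y, (Δ φ) (y + x) * greenKernel (x - (y + x))
      = (4 * Real.pi)⁻¹ * (‖y‖⁻¹ * (Δ φ) (y + x)) := fun y => by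
    rw [greenKernel_eq, show x - (y + x) = -y by abel, norm_neg]; ring
  simp_rw [e]
  rw [integral_const_mul, h]
  field_simp

/-- The Newton potential of `-f` solves `ΔU = f` in the sense of distributions. -/
theorem solvesPoisson_newtonPotential_neg {f : R3 → ℝ} (h1 : MemLp f 1 volume)
    (hi : MemLp f ⊤ volume) : SolvesPoisson (newtonPotential (-f)) f := by
  refine ⟨(contDiff_newtonPotential h1.neg hi.neg).continuous.locallyIntegrable,
    (memLp_one_iff_integrable.mp h1).locallyIntegrable, fun φ hφ hc => ?_⟩
  have hφ2 : ContDiff ℝ 2 φ := contDiff_infty.mp hφ 2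
  have hΔ := continuous_laplacian hφ2
  have hΔc := hasCompactSupport_laplacian hc
  have hΔ1 : MemLp (Δ φ) 1 volume := hΔ.memLp_of_hasCompactSupport hΔc
  have hΔi : MemLp (Δ φ) ⊤ volume := hΔ.memLp_of_hasCompactSupport hΔc
  have hf := memLp_one_iff_integrable.mp h1
  -- Fubini is justified because the potential of `|f|` is bounded and `Δφ` is integrable; the
  -- evenness of `G` then lets the potential fall on `Δφ`.
  have hprod : Integrable (Function.uncurry fun x y : R3 =>
      -(f y) * greenKernel (x - y) * (Δ φ) x) (volume.prod volume) := by
    have hm : AEStronglyMeasurable (Function.uncurry fun x y : R3 =>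
        -(f y) * greenKernel (x - y) * (Δ φ) x) (volume.prod volume) := by
      refine ((h1.1.neg.comp_quasiMeasurePreserving Measure.quasiMeasurePreserving_snd).mul
        ?_).mul (hΔ.comp continuous_fst).aestronglyMeasurable
      exact (measurable_greenKernel.comp
        (measurable_fst.sub measurable_snd)).aestronglyMeasurable
    refine ⟨hm, ?_⟩
    rw [HasFiniteIntegral, lintegral_prod _ hm.enorm]
    calc ∫⁻ x, ∫⁻ y, ‖Function.uncurry (fun x y : R3 =>
          -(f y) * greenKernel (x - y) * (Δ φ) x) (x, y)‖ₑ
        ≤ ∫⁻ x, rieszPotential 1 f x * ‖(Δ φ) x‖ₑ := by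
          refine lintegral_mono fun x => ?_
          simp only [Function.uncurry_apply_pair, enorm_mul, enorm_neg]
          rw [lintegral_mul_const' _ _ enorm_ne_top]
          gcongr ?_ * _
          refine lintegral_mono fun y => ?_
          rw [mul_comm]
          gcongr
          exact enorm_greenKernel_le _
      _ ≤ ∫⁻ x, ENNReal.ofReal ((4 * Real.pi / (3 - 1) + 1) * l1AddLinfty f) * ‖(Δ φ) x‖ₑ := by
          refine lintegral_mono fun x => ?_
          gcongr
          exact rieszPotential_le_ofReal h1 hi zero_le_one (by norm_num) x
      _ < ⊤ := by
          rw [lintegral_const_mul' _ _ ENNReal.ofReal_ne_top, ← eLpNorm_one_eq_lintegral_enorm]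
          exact ENNReal.mul_lt_top ENNReal.ofReal_lt_top hΔ1.2
  calc ∫ x, newtonPotential (-f) x * (Δ φ) x
      = ∫ x, ∫ y, -(f y) * greenKernel (x - y) * (Δ φ) x := by
        congr 1 with x
        rw [newtonPotential_apply, integral_mul_const]
        rfl
    _ = ∫ y, ∫ x, -(f y) * greenKernel (x - y) * (Δ φ) x := integral_integral_swap hprod
    _ = ∫ y, f y * φ y := by
        congr 1 with y
        have e : ∀ x, -(f y) * greenKernel (x - y) * (Δ φ) x
            = -(f y) * ((Δ φ) x * greenKernel (y - x)) := fun x => by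
          rw [greenKernel_eq, greenKernel_eq, norm_sub_rev]; ring
        simp_rw [e]
        rw [integral_const_mul, ← newtonPotential_apply, newtonPotential_laplacian hφ2 hc]
        ring

end FundamentalSolution

/-! ### Hammerstein equations with a positive operator and a monotone nonlinearity. -/

section MonotoneOperator

/-- Solvability of `u + c A u = A (Ψ u)` for a positive operator `A` and a `c`-Lipschitz `Ψ`. -/
lemma exists_add_smul_eq_of_positive {H : Type*} [NormedAddCommGroup H] [InnerProductSpace ℝ H]
    [CompleteSpace H] (A : H →L[ℝ] H) (hA : ∀ u, 0 ≤ inner ℝ (A u) u) {Ψ : H → H} {c : ℝ≥0}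
    (hc : 0 < c) (hΨ : LipschitzWith c Ψ) : ∃ u, u + (c : ℝ) • A u = A (Ψ u) := by
  have hc' : (0 : ℝ) < c := hc
  set T : H →L[ℝ] H := ContinuousLinearMap.id ℝ H + (c : ℝ) • A with hT
  have hTu : ∀ u, T u = u + (c : ℝ) • A u := fun u => by simp [hT]
  set B : H →L[ℝ] H →L[ℝ] ℝ := (innerSL ℝ).comp T with hB
  have hBu : ∀ u v, B u v = inner ℝ (T u) v := fun u v => by simp [hB]
  have hcoer : IsCoercive B := by
    refine ⟨1, one_pos, fun u => ?_⟩
    rw [hBu, hTu, inner_add_left, real_inner_self_eq_norm_mul_norm, inner_smul_left, one_mul]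
    exact le_add_of_nonneg_right (mul_nonneg hc'.le (hA u))
  -- Lax–Milgram inverts `T = I + cA`, so the equation becomes the fixed point problem `u = T⁻¹ A
  -- Ψ(u)`.
  set e := hcoer.continuousLinearEquivOfBilin with he
  have heT : ∀ u, e u = T u := fun u => ext_inner_right ℝ fun v => by
    rw [he, hcoer.continuousLinearEquivOfBilin_apply, hBu]
  -- Positivity alone gives `‖T⁻¹ A‖ ≤ 1/c`, not quite a contraction with `Ψ`. Boundedness of `A`
  -- supplies the extra `N > 0`; using `1 + ‖A‖` avoids dividing by zero when `A = 0`.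
  set N : ℝ := (1 + ‖A‖)⁻¹ ^ 2 with hN
  have hN0 : 0 < N := by positivity
  set K : ℝ := (Real.sqrt ((c : ℝ) ^ 2 + N))⁻¹ with hK
  have hK0 : 0 < K := by positivity
  have hS : ∀ x, ‖e.symm (A x)‖ ≤ K * ‖x‖ := by
    intro x
    set y := e.symm (A x) with hy
    have h1 : y + (c : ℝ) • A y = A x := by rw [← hTu, ← heT, hy, e.apply_symm_apply]
    -- Since `A z = y`, positivity gives `⟨z, y⟩ ≥ 0`, so `x = z + c y` satisfies `‖x‖² ≥ ‖z‖² + c²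
    -- ‖y‖²`; and `‖z‖` is bounded below by a multiple of `‖y‖`.
    set z := x - (c : ℝ) • y with hz
    have h2 : A z = y := by rw [hz, map_sub, map_smul, ← h1]; abel
    have h3 : x = z + (c : ℝ) • y := by rw [hz]; abel
    have h4 : ‖z‖ ^ 2 + (c : ℝ) ^ 2 * ‖y‖ ^ 2 ≤ ‖x‖ ^ 2 := by
      have := norm_add_sq_real z ((c : ℝ) • y)
      rw [← h3, inner_smul_right, norm_smul, Real.norm_of_nonneg hc'.le, ← h2, real_inner_comm,
        h2] at this
      have hp := hA z
      rw [h2] at hp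
      nlinarith [mul_nonneg hc'.le hp]
    have h5 : N * ‖y‖ ^ 2 ≤ ‖z‖ ^ 2 := by
      have h6 : ‖y‖ ≤ (1 + ‖A‖) * ‖z‖ := by
        rw [← h2]
        refine (A.le_opNorm z).trans ?_
        gcongr
        linarith
      rw [hN, ← mul_pow]
      gcongr
      rw [inv_mul_le_iff₀ (by positivity)]
      exact h6
    rw [hK, inv_mul_eq_div, le_div_iff₀ (by positivity)]
    refine le_of_sq_le_sq ?_ (norm_nonneg _)
    rw [mul_pow, Real.sq_sqrt (by positivity)]
    linarith
  have hKc : K * c < 1 := by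
    rw [hK, inv_mul_lt_iff₀ (by positivity), mul_one]
    exact Real.lt_sqrt_of_sq_lt (by linarith)
  have hcontr : ContractingWith (K.toNNReal * c) fun u => e.symm (A (Ψ u)) := by
    refine ⟨?_, LipschitzWith.of_dist_le_mul fun u v => ?_⟩
    · rw [← NNReal.coe_lt_coe]
      push_cast
      rwa [Real.coe_toNNReal _ hK0.le]
    · rw [dist_eq_norm, ← map_sub, ← map_sub]
      push_cast
      rw [Real.coe_toNNReal _ hK0.le, mul_assoc]
      refine (hS _).trans ?_
      gcongr
      rw [← dist_eq_norm]
      exact hΨ.dist_le_mul u v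
  obtain ⟨u, hu⟩ : ∃ u, e.symm (A (Ψ u)) = u := ⟨_, hcontr.fixedPoint_isFixedPt⟩
  refine ⟨u, ?_⟩
  rw [← hTu, ← heT]
  nth_rw 1 [← hu]
  rw [e.apply_symm_apply]

lemma exp_sub_exp_le_of_nonpos {a b : ℝ} (hab : a ≤ b) (hb : b ≤ 0) :
    Real.exp b - Real.exp a ≤ b - a := by
  have h1 := Real.add_one_le_exp (a - b)
  have h2 : Real.exp a = Real.exp b * Real.exp (a - b) := by rw [← Real.exp_add]; ring_nf
  have h3 : Real.exp b ≤ 1 := Real.exp_le_one_iff.mpr hb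
  nlinarith [Real.exp_pos b]

/-- The slopes of `e^{min(t,0)}` lie in `[0, 1]`; subtracting it from `t/2` leaves slopes in `[-1/2,
1/2]`. The `-1` makes the function vanish at 0, as composition on `Lp` requires. -/
lemma lipschitzWith_half_sub_truncatedExp :
    LipschitzWith (1 / 2) fun t : ℝ => t / 2 - (Real.exp (min t 0) - 1) := by
  have key : ∀ s t : ℝ, s ≤ t → |(t / 2 - (Real.exp (min t 0) - 1))
      - (s / 2 - (Real.exp (min s 0) - 1))| ≤ 1 / 2 * |t - s| := by
    intro s t hst
    have h1 : min s 0 ≤ min t 0 := min_le_min_right 0 hst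
    have h2 := exp_sub_exp_le_of_nonpos h1 (min_le_right t 0)
    have h3 := Real.exp_le_exp.mpr h1
    have h4 : min t 0 - min s 0 ≤ t - s := by
      rcases le_total s 0 with h | h
      · rw [min_eq_left h]; linarith [min_le_left t 0]
      · rw [min_eq_right h, min_eq_right (h.trans hst)]; linarith
    rw [abs_of_nonneg (sub_nonneg.mpr hst), abs_le]
    constructor <;> linarith
  refine LipschitzWith.of_dist_le_mul fun s t => ?_
  rw [Real.dist_eq, Real.dist_eq]
  push_cast
  rcases le_total s t with h | h
  · rw [abs_sub_comm, abs_sub_comm s t]; exact key s t h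
  · exact key t s h

variable {X : Type*} [MeasurableSpace X] {μ : Measure X} {k : X → X → ℝ}
  {M : ℝ}

lemma memLp_two_kernel (hk : StronglyMeasurable (Function.uncurry k))
    (hM : ∀ x, eLpNorm (k x) 2 μ ≤ ENNReal.ofReal M) (x : X) : MemLp (k x) 2 μ :=
  ⟨(hk.comp_measurable measurable_prodMk_left).aestronglyMeasurable,
    (hM x).trans_lt ENNReal.ofReal_lt_top⟩

lemma norm_kernel_toLp_le (hk : StronglyMeasurable (Function.uncurry k)) (hM0 : 0 ≤ M)
    (hM : ∀ x, eLpNorm (k x) 2 μ ≤ ENNReal.ofReal M) (x : X) :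
    ‖(memLp_two_kernel hk hM x).toLp‖ ≤ M := by
  rw [Lp.norm_toLp]
  exact ENNReal.toReal_le_of_le_ofReal hM0 (hM x)

lemma integral_kernel_mul_eq_inner (hk : StronglyMeasurable (Function.uncurry k))
    (hM : ∀ x, eLpNorm (k x) 2 μ ≤ ENNReal.ofReal M) (u : Lp ℝ 2 μ) (x : X) :
    ∫ y, k x y * u y ∂μ = inner ℝ (memLp_two_kernel hk hM x).toLp u := by
  rw [L2.inner_def]
  refine integral_congr_ae ?_
  filter_upwards [(memLp_two_kernel hk hM x).coeFn_toLp] with y hy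
  rw [hy]
  simp [mul_comm]

lemma stronglyMeasurable_integral_kernel_mul [SFinite μ]
    (hk : StronglyMeasurable (Function.uncurry k))
    {u : X → ℝ} (hu : AEStronglyMeasurable u μ) :
    StronglyMeasurable fun x => ∫ y, k x y * u y ∂μ := by
  have e : (fun x => ∫ y, k x y * u y ∂μ) = fun x => ∫ y, k x y * hu.mk u y ∂μ := by
    ext x
    refine integral_congr_ae ?_
    filter_upwards [hu.ae_eq_mk] with y hy
    rw [hy]
  rw [e]
  exact StronglyMeasurable.integral_prod_right (f := fun x y => k x y * hu.mk u y)
    (hk.mul (hu.stronglyMeasurable_mk.comp_measurable measurable_snd))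

/-- The integral operator with a kernel of uniformly bounded `L²` norm. -/
lemma exists_kernelOperator [IsFiniteMeasure μ]
    (hk : StronglyMeasurable (Function.uncurry k)) (hM0 : 0 ≤ M)
    (hM : ∀ x, eLpNorm (k x) 2 μ ≤ ENNReal.ofReal M) :
    ∃ A : Lp ℝ 2 μ →L[ℝ] Lp ℝ 2 μ, ∀ u, A u =ᵐ[μ] fun x => ∫ y, k x y * u y ∂μ := by
  have hbound : ∀ (u : Lp ℝ 2 μ) (x : X), ‖∫ y, k x y * u y ∂μ‖ ≤ M * ‖u‖ := fun u x => by
    rw [integral_kernel_mul_eq_inner hk hM]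
    refine (norm_inner_le_norm _ _).trans ?_
    gcongr
    exact norm_kernel_toLp_le hk hM0 hM x
  have hmem : ∀ u : Lp ℝ 2 μ, MemLp (fun x => ∫ y, k x y * u y ∂μ) 2 μ := fun u =>
    MemLp.of_bound (stronglyMeasurable_integral_kernel_mul hk
      (Lp.aestronglyMeasurable u)).aestronglyMeasurable (M * ‖u‖)
      (Filter.Eventually.of_forall (hbound u))
  refine ⟨LinearMap.mkContinuous ⟨⟨fun u => (hmem u).toLp, fun u v => ?_⟩, fun c u => ?_⟩
    ((measureUnivNNReal μ : ℝ) ^ (ENNReal.toReal 2)⁻¹ * M) fun u => ?_, fun u => (hmem u).coeFn_toLp⟩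
  · rw [← MemLp.toLp_add]
    refine MemLp.toLp_congr _ _ (Filter.Eventually.of_forall fun x => ?_)
    simp only [Pi.add_apply, integral_kernel_mul_eq_inner hk hM, inner_add_right]
  · simp only [RingHom.id_apply]
    rw [← MemLp.toLp_const_smul]
    refine MemLp.toLp_congr _ _ (Filter.Eventually.of_forall fun x => ?_)
    simp only [Pi.smul_apply, integral_kernel_mul_eq_inner hk hM, inner_smul_right, smul_eq_mul]
  · change ‖(hmem u).toLp‖ ≤ _
    have h := Lp.norm_le_of_ae_bound (f := (hmem u).toLp) (C := M * ‖u‖) (by positivity) (by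
      filter_upwards [(hmem u).coeFn_toLp] with x hx
      rw [hx]
      exact hbound u x)
    exact h.trans (le_of_eq (by ring))

lemma integrable_kernel_mul_mul [IsFiniteMeasure μ]
    (hk : StronglyMeasurable (Function.uncurry k))
    (hM : ∀ x, eLpNorm (k x) 2 μ ≤ ENNReal.ofReal M) {u : X → ℝ} (hu : MemLp u 2 μ) :
    Integrable (fun p : X × X => k p.1 p.2 * (u p.1 * u p.2)) (μ.prod μ) := by
  have hm : AEStronglyMeasurable (fun p : X × X => k p.1 p.2 * (u p.1 * u p.2)) (μ.prod μ) :=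
    hk.aestronglyMeasurable.mul
      ((hu.1.comp_quasiMeasurePreserving Measure.quasiMeasurePreserving_fst).mul
        (hu.1.comp_quasiMeasurePreserving Measure.quasiMeasurePreserving_snd))
  refine ⟨hm, ?_⟩
  rw [HasFiniteIntegral, lintegral_prod _ hm.enorm]
  have h1 : ∀ x, ∫⁻ y, ‖k x y * (u x * u y)‖ₑ ∂μ
      ≤ ‖u x‖ₑ * (ENNReal.ofReal M * eLpNorm u 2 μ) := by
    intro x
    have e : ∀ y, ‖k x y * (u x * u y)‖ₑ = ‖u x‖ₑ * ‖(k x • u) y‖ₑ := fun y => by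
      simp only [Pi.smul_apply', smul_eq_mul, enorm_mul]; ring
    simp_rw [e]
    rw [lintegral_const_mul' _ _ enorm_ne_top, ← eLpNorm_one_eq_lintegral_enorm]
    gcongr
    refine (eLpNorm_smul_le_mul_eLpNorm (p := 2) (q := 2) (r := 1) hu.1
      (memLp_two_kernel hk hM x).1).trans ?_
    gcongr
    exact hM x
  refine (lintegral_mono h1).trans_lt ?_
  have hne : ENNReal.ofReal M * eLpNorm u 2 μ ≠ ⊤ := ENNReal.mul_ne_top ENNReal.ofReal_ne_top hu.2.ne
  rw [lintegral_mul_const' _ _ hne, ← eLpNorm_one_eq_lintegral_enorm]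
  exact ENNReal.mul_lt_top (hu.mono_exponent (by norm_num)).2 hne.lt_top

/-- A Hammerstein equation with exponential nonlinearity and positive definite kernel. -/
theorem exists_eq_neg_integral_kernel_mul_exp [IsFiniteMeasure μ]
    (hk : StronglyMeasurable (Function.uncurry k))
    (hM0 : 0 ≤ M) (hM : ∀ x, eLpNorm (k x) 2 μ ≤ ENNReal.ofReal M) (hk0 : ∀ x y, 0 ≤ k x y)
    (hpos : ∀ u : X → ℝ, MemLp u 2 μ → 0 ≤ ∫ p : X × X, k p.1 p.2 * (u p.1 * u p.2) ∂(μ.prod μ)) :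
    ∃ U : X → ℝ, StronglyMeasurable U ∧ (∀ x, U x ≤ 0) ∧
      ∀ x, U x = -∫ y, k x y * Real.exp (U y) ∂μ := by
  obtain ⟨A, hA⟩ := exists_kernelOperator hk hM0 hM
  have hApos : ∀ u, 0 ≤ inner ℝ (A u) u := by
    intro u
    have hint := integrable_kernel_mul_mul hk hM (Lp.memLp u)
    have h := hpos u (Lp.memLp u)
    rw [integral_prod _ hint] at h
    rw [L2.inner_def]
    refine h.trans (le_of_eq (integral_congr_ae ?_))
    filter_upwards [hA u] with x hx
    rw [hx]
    simp only [RCLike.inner_apply, RCLike.conj_to_real]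
    rw [← integral_const_mul]
    congr 1 with y
    ring
  have hψ0 : (0 : ℝ) / 2 - (Real.exp (min 0 0) - 1) = 0 := by simp
  set one : Lp ℝ 2 μ := (memLp_const (1 : ℝ)).toLp with hone
  -- With `ψ(t) = t/2 - (e^{min(t,0)} - 1)`, the equation `u + A u / 2 = A(ψ(u) - 1)` is `u = -A
  -- e^{min(u,0)}`. The constant 1 lies in `L²(μ)` because `μ` is finite.
  obtain ⟨u, hu⟩ := exists_add_smul_eq_of_positive A hApos (c := 1 / 2) (by norm_num)
    (Ψ := fun u => lipschitzWith_half_sub_truncatedExp.compLp hψ0 u - one) (by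
      have h := (lipschitzWith_half_sub_truncatedExp.lipschitzWith_compLp
        (p := 2) (μ := μ) hψ0).sub (LipschitzWith.const one)
      simpa using h)
  have hu' : u = -A ((1 / 2 : ℝ) • u - (lipschitzWith_half_sub_truncatedExp.compLp hψ0 u - one)) := by
    rw [map_sub, map_smul, ← hu]
    push_cast
    abel
  -- The class `u` is only defined a.e.; the integral gives a representative for which sign and
  -- equation hold at every point.
  set U : X → ℝ := fun x => -∫ y, k x y * Real.exp (min (u y) 0) ∂μ with hU
  have hUu : u =ᵐ[μ] U := by
    set v := (1 / 2 : ℝ) • u - (lipschitzWith_half_sub_truncatedExp.compLp hψ0 u - one) with hv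
    have hvexp : v =ᵐ[μ] fun y => Real.exp (min (u y) 0) := by
      filter_upwards [Lp.coeFn_sub ((1 / 2 : ℝ) • u)
          (lipschitzWith_half_sub_truncatedExp.compLp hψ0 u - one),
        Lp.coeFn_sub (lipschitzWith_half_sub_truncatedExp.compLp hψ0 u) one,
        Lp.coeFn_smul (1 / 2 : ℝ) u,
        lipschitzWith_half_sub_truncatedExp.coeFn_compLp hψ0 u,
        (memLp_const (1 : ℝ) : MemLp _ 2 μ).coeFn_toLp] with y h1 h2 h3 h4 h5
      rw [hv, h1, Pi.sub_apply, h2, Pi.sub_apply, h3, h4, hone, h5]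
      simp only [Pi.smul_apply, Function.comp_apply, smul_eq_mul]
      ring
    have h1 : u =ᵐ[μ] ⇑(-A v) := by rw [← hu']
    filter_upwards [h1, Lp.coeFn_neg (A v), hA v] with x hx1 hx2 hx3
    rw [hx1, hx2, Pi.neg_apply, hx3, hU]
    congr 1
    refine integral_congr_ae ?_
    filter_upwards [hvexp] with y hy
    rw [hy]
  have hU0 : ∀ x, U x ≤ 0 := fun x =>
    neg_nonpos.mpr (integral_nonneg fun y => mul_nonneg (hk0 x y) (Real.exp_pos _).le)
  refine ⟨U, ?_, hU0, fun x => ?_⟩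
  · refine (stronglyMeasurable_integral_kernel_mul hk (u := fun y => Real.exp (min (u y) 0)) ?_).neg
    exact Real.continuous_exp.comp_aestronglyMeasurable
      ((Lp.aestronglyMeasurable u).inf aestronglyMeasurable_const)
  · refine congrArg Neg.neg (integral_congr_ae ?_)
    filter_upwards [hUu] with y hy
    rw [hy, min_eq_left (hU0 y)]

end MonotoneOperator

/-! ### Positive definiteness of the Green's function via Gaussian mixtures. -/

section PositiveDefinite

/-- Positivity passes to mixtures `k = ∫ F(·, z) dκ(z)` by Fubini. Because `F ≥ 0`, the absolute
double integral is just that of `|k w|`, so no further integrability is needed. -/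
lemma integral_mixture_mul_nonneg {P Z : Type*} [MeasurableSpace P] [MeasurableSpace Z]
    {ν : Measure P} [SFinite ν] {κ : Measure Z} [SFinite κ] {F : P → Z → ℝ} {k w : P → ℝ}
    (hFm : Measurable (Function.uncurry F)) (hF0 : ∀ᵐ p ∂ν, ∀ᵐ z ∂κ, 0 ≤ F p z)
    (hF : ∀ᵐ p ∂ν, Integrable (F p) κ ∧ ∫ z, F p z ∂κ = k p)
    (hw : AEStronglyMeasurable w ν) (hkw : Integrable (fun p => k p * w p) ν)
    (hpos : ∀ᵐ z ∂κ, 0 ≤ ∫ p, F p z * w p ∂ν) : 0 ≤ ∫ p, k p * w p ∂ν := by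
  have hint : Integrable (Function.uncurry fun p z => F p z * w p) (ν.prod κ) := by
    refine (integrable_prod_iff ?_).mpr ⟨?_, ?_⟩
    · exact hFm.aestronglyMeasurable.mul
        (hw.comp_quasiMeasurePreserving Measure.quasiMeasurePreserving_fst)
    · filter_upwards [hF] with p hp
      exact hp.1.mul_const (w p)
    · refine hkw.norm.congr ?_
      filter_upwards [hF, hF0] with p hp hp0
      have e : ∫ z, ‖Function.uncurry (fun p z => F p z * w p) (p, z)‖ ∂κ
          = ∫ z, F p z * ‖w p‖ ∂κ := by
        refine integral_congr_ae ?_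
        filter_upwards [hp0] with z hz
        simp only [Function.uncurry_apply_pair]
        rw [norm_mul, Real.norm_of_nonneg hz]
      rw [e, integral_mul_const, hp.2, norm_mul, Real.norm_of_nonneg]
      rw [← hp.2]
      exact integral_nonneg_of_ae hp0
  have e : ∫ p, k p * w p ∂ν = ∫ p, ∫ z, F p z * w p ∂κ ∂ν := by
    refine integral_congr_ae ?_
    filter_upwards [hF] with p hp
    rw [integral_mul_const, hp.2]
  rw [e, integral_integral_swap hint]
  exact integral_nonneg_of_ae hpos

lemma integrable_exp_neg_mul_norm_sq {b : ℝ} (hb : 0 < b) (m : R3) :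
    Integrable fun z : R3 => Real.exp (-b * ‖z - m‖ ^ 2) := by
  have h1 : Integrable fun z : R3 => Real.exp (-b * ‖z‖ ^ 2) := by
    refine Integrable.of_integral_ne_zero ?_
    rw [GaussianFourier.integral_rexp_neg_mul_sq_norm hb]
    positivity
  exact h1.comp_sub_right m

lemma exp_neg_mul_norm_sub_sq_mul (s : ℝ) (x y z : R3) :
    Real.exp (-(2 * s) * ‖z - x‖ ^ 2) * Real.exp (-(2 * s) * ‖z - y‖ ^ 2)
      = Real.exp (-s * ‖x - y‖ ^ 2) *
        Real.exp (-(4 * s) * ‖z - (1 / 2 : ℝ) • (x + y)‖ ^ 2) := by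
  rw [← Real.exp_add, ← Real.exp_add]
  congr 1
  have h := parallelogram_law_with_norm ℝ (z - x) (z - y)
  have e1 : z - x + (z - y) = (2 : ℝ) • (z - (1 / 2 : ℝ) • (x + y)) := by module
  have e2 : z - x - (z - y) = -(x - y) := by abel
  rw [e1, e2, norm_neg, norm_smul, Real.norm_of_nonneg (by norm_num)] at h
  linear_combination s * h

/-- A Gaussian in `x - y` is, up to normalisation, the integral over `z` of a product of Gaussians
in `z - x` and `z - y`; each product contributes the square of a single integral. -/
lemma integral_exp_neg_mul_norm_sub_sq_nonneg {μ : Measure R3} [IsFiniteMeasure μ] {s : ℝ}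
    (hs : 0 < s) {u : R3 → ℝ} (hu : Integrable u μ) :
    0 ≤ ∫ p : R3 × R3, Real.exp (-s * ‖p.1 - p.2‖ ^ 2) * (u p.1 * u p.2) ∂(μ.prod μ) := by
  set c : ℝ := ∫ z : R3, Real.exp (-(4 * s) * ‖z‖ ^ 2) with hc
  have hc0 : 0 < c := by
    rw [hc, GaussianFourier.integral_rexp_neg_mul_sq_norm (by positivity)]
    positivity
  have huu : Integrable (fun p : R3 × R3 => u p.1 * u p.2) (μ.prod μ) := hu.mul_prod hu
  refine integral_mixture_mul_nonneg (κ := (volume : Measure R3))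
    (F := fun p z => c⁻¹ * (Real.exp (-(2 * s) * ‖z - p.1‖ ^ 2)
      * Real.exp (-(2 * s) * ‖z - p.2‖ ^ 2))) ?_ ?_ ?_ huu.1 ?_ ?_
  · unfold Function.uncurry; fun_prop
  · exact Filter.Eventually.of_forall fun p => Filter.Eventually.of_forall fun z => by positivity
  · refine Filter.Eventually.of_forall fun p => ?_
    simp_rw [exp_neg_mul_norm_sub_sq_mul]
    refine ⟨((integrable_exp_neg_mul_norm_sq (by positivity) _).const_mul _).const_mul _, ?_⟩
    rw [integral_const_mul, integral_const_mul,
      integral_sub_right_eq_self (fun z : R3 => Real.exp (-(4 * s) * ‖z‖ ^ 2)), ← hc]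
    field_simp
  · refine huu.bdd_mul (c := 1) (by fun_prop) (Filter.Eventually.of_forall fun p => ?_)
    rw [Real.norm_of_nonneg (Real.exp_pos _).le, Real.exp_le_one_iff, neg_mul]
    exact neg_nonpos.mpr (by positivity)
  · refine Filter.Eventually.of_forall fun z => ?_
    have e : ∀ p : R3 × R3, c⁻¹ * (Real.exp (-(2 * s) * ‖z - p.1‖ ^ 2)
        * Real.exp (-(2 * s) * ‖z - p.2‖ ^ 2)) * (u p.1 * u p.2)
        = c⁻¹ * ((Real.exp (-(2 * s) * ‖z - p.1‖ ^ 2) * u p.1)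
          * (Real.exp (-(2 * s) * ‖z - p.2‖ ^ 2) * u p.2)) := fun p => by ring
    simp_rw [e]
    rw [integral_const_mul, integral_prod_mul (fun x => Real.exp (-(2 * s) * ‖z - x‖ ^ 2) * u x)
      (fun x => Real.exp (-(2 * s) * ‖z - x‖ ^ 2) * u x)]
    exact mul_nonneg (by positivity) (mul_self_nonneg _)

/-- The Green's function is a positive definite kernel. -/
theorem integral_greenKernel_mul_nonneg {μ : Measure R3} [IsFiniteMeasure μ] [NullSingletonClass μ]
    {u : R3 → ℝ} (hu : Integrable u μ)
    (hGu : Integrable (fun p : R3 × R3 => greenKernel (p.1 - p.2) * (u p.1 * u p.2))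
      (μ.prod μ)) :
    0 ≤ ∫ p : R3 × R3, greenKernel (p.1 - p.2) * (u p.1 * u p.2) ∂(μ.prod μ) := by
  have hΓ : 0 < Real.Gamma (1 / 2) := Real.Gamma_pos_of_pos (by norm_num)
  -- The mixture formula fails on the diagonal, where `greenKernel` takes the value 0; the diagonal
  -- is null since `μ` has no atoms.
  have hdiag : ∀ᵐ p ∂(μ.prod μ), p.1 - p.2 ≠ 0 := by
    rw [ae_iff]
    have hset : {p : R3 × R3 | ¬(p.1 - p.2 ≠ 0)} = Set.diagonal R3 := by
      ext p; simp [sub_eq_zero]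
    rw [hset, Measure.measure_prod_null isClosed_diagonal.measurableSet]
    refine Filter.Eventually.of_forall fun x => ?_
    have : Prod.mk x ⁻¹' Set.diagonal R3 = {x} := by ext y; simp [eq_comm]
    simp [this]
  -- For `r > 0`, `1/r = Γ(1/2)⁻¹ ∫₀^∞ s^{-1/2} e^{-r² s} ds`.
  refine integral_mixture_mul_nonneg (κ := (volume : Measure ℝ).restrict (Set.Ioi 0))
    (F := fun p s => (4 * Real.pi * Real.Gamma (1 / 2))⁻¹ *
      (s ^ ((1 / 2 : ℝ) - 1) * Real.exp (-(‖p.1 - p.2‖ ^ 2 * s)))) ?_ ?_ ?_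
    (hu.mul_prod hu).1 hGu ?_
  · unfold Function.uncurry; fun_prop
  · refine Filter.Eventually.of_forall fun p => ?_
    filter_upwards [ae_restrict_mem measurableSet_Ioi] with s hs
    have hs' : (0 : ℝ) < s := hs
    positivity
  · filter_upwards [hdiag] with p hp
    have hr : 0 < ‖p.1 - p.2‖ ^ 2 := by positivity
    have hI := Real.integral_rpow_mul_exp_neg_mul_Ioi (a := 1 / 2) (by norm_num) hr
    refine ⟨Integrable.const_mul (Integrable.of_integral_ne_zero ?_) _, ?_⟩
    · rw [hI]; positivity
    · rw [integral_const_mul, hI, greenKernel_eq, ← Real.sqrt_eq_rpow,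
        one_div (‖p.1 - p.2‖ ^ 2), Real.sqrt_inv, Real.sqrt_sq (norm_nonneg _)]
      field_simp
  · filter_upwards [ae_restrict_mem measurableSet_Ioi] with s hs
    have hs' : (0 : ℝ) < s := hs
    have e : ∀ p : R3 × R3, (4 * Real.pi * Real.Gamma (1 / 2))⁻¹ *
        (s ^ ((1 / 2 : ℝ) - 1) * Real.exp (-(‖p.1 - p.2‖ ^ 2 * s))) * (u p.1 * u p.2)
        = ((4 * Real.pi * Real.Gamma (1 / 2))⁻¹ * s ^ ((1 / 2 : ℝ) - 1)) *
          (Real.exp (-s * ‖p.1 - p.2‖ ^ 2) * (u p.1 * u p.2)) := fun p => by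
      rw [show -(‖p.1 - p.2‖ ^ 2 * s) = -s * ‖p.1 - p.2‖ ^ 2 by ring]; ring
    simp_rw [e]
    rw [integral_const_mul]
    exact mul_nonneg (by positivity) (integral_exp_neg_mul_norm_sub_sq_nonneg hs' hu)

end PositiveDefinite

/-! ### Solving the integral equation in `L²` of the weighted measure. -/

section Existence

lemma stronglyMeasurable_greenKernel_sub :
    StronglyMeasurable (Function.uncurry fun x y : R3 => greenKernel (x - y)) :=
  (measurable_greenKernel.comp (measurable_fst.sub measurable_snd)).stronglyMeasurable

lemma stronglyMeasurable_newtonPotential {ρ : R3 → ℝ} (hρ : AEStronglyMeasurable ρ volume) :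
    StronglyMeasurable (newtonPotential ρ) := by
  have h := stronglyMeasurable_integral_kernel_mul stronglyMeasurable_greenKernel_sub hρ
  convert h using 2 with x
  rw [newtonPotential_apply]
  congr 1 with y
  ring

lemma rieszKernel_rpow {s r : ℝ} (hr : 0 ≤ r) (z : R3) :
    rieszKernel s z ^ r = rieszKernel (s * r) z := by
  unfold rieszKernel
  rw [ENNReal.ofReal_rpow_of_nonneg (by positivity) hr, ← Real.rpow_mul (norm_nonneg _), neg_mul]

/-- Solvability of `U = -G * (h e^U)` for nonnegative `h ∈ L¹ ∩ L^∞`. -/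
theorem exists_eq_newtonPotential_neg_mul_exp {h : R3 → ℝ} (hm : Measurable h) (h0 : ∀ x, 0 ≤ h x)
    (h1 : MemLp h 1 volume) (hi : MemLp h ⊤ volume) :
    ∃ U : R3 → ℝ, StronglyMeasurable U ∧ (∀ x, U x ≤ 0) ∧
      U = newtonPotential (-fun x => h x * Real.exp (U x)) := by
  set d : R3 → ℝ≥0∞ := fun x => ENNReal.ofReal (h x) with hd
  have hdm : Measurable d := hm.ennreal_ofReal
  set μ : Measure R3 := volume.withDensity d with hμ
  have hde : ∀ x, d x = ‖h x‖ₑ := fun x => (Real.enorm_of_nonneg (h0 x)).symm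
  have : IsFiniteMeasure μ := by
    refine isFiniteMeasure_withDensity ?_
    simp_rw [hde]
    rw [← eLpNorm_one_eq_lintegral_enorm]
    exact h1.2.ne
  have : NullSingletonClass μ :=
    ⟨fun x => withDensity_absolutelyContinuous volume d (measure_singleton x)⟩
  set D : ℝ := (4 * Real.pi / (3 - 2) + 1) * l1AddLinfty h with hD
  have hD0 : 0 ≤ D := by rw [hD]; unfold l1AddLinfty; norm_num only; positivity
  -- As `G² ≤ |z|^{-2}`, the squared `L²(μ)` norm of the kernel is at most the Riesz potential of
  -- order 2 of `h`, which is bounded by `D`.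
  have hM : ∀ x : R3, eLpNorm (fun y => greenKernel (x - y)) 2 μ
      ≤ ENNReal.ofReal (D ^ (1 / 2 : ℝ)) := by
    intro x
    rw [eLpNorm_eq_lintegral_rpow_enorm_toReal (by norm_num) (by norm_num),
      ← ENNReal.ofReal_rpow_of_nonneg hD0 (by norm_num)]
    simp only [ENNReal.toReal_ofNat]
    gcongr
    rw [hμ, lintegral_withDensity_eq_lintegral_mul _ hdm (by
      have := measurable_greenKernel
      fun_prop)]
    refine le_trans (lintegral_mono fun y => ?_)
      (rieszPotential_le_ofReal h1 hi zero_le_two (by norm_num) x)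
    rw [Pi.mul_apply, hde, mul_comm]
    gcongr
    calc ‖greenKernel (x - y)‖ₑ ^ (2 : ℝ) ≤ rieszKernel 1 (x - y) ^ (2 : ℝ) := by
          gcongr; exact enorm_greenKernel_le _
      _ = _ := by rw [rieszKernel_rpow (by norm_num), one_mul]
  obtain ⟨U, hUm, hU0, hU⟩ := exists_eq_neg_integral_kernel_mul_exp (μ := μ)
    stronglyMeasurable_greenKernel_sub (by positivity) hM
    (fun x y => greenKernel_nonneg _) (fun u hu =>
      integral_greenKernel_mul_nonneg (hu.integrable (by norm_num))
        (integrable_kernel_mul_mul (k := fun x y => greenKernel (x - y))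
          stronglyMeasurable_greenKernel_sub hM hu))
  refine ⟨U, hUm, hU0, funext fun x => ?_⟩
  nth_rw 1 [hU x]
  rw [newtonPotential_apply, hμ, integral_withDensity_eq_integral_toReal_smul hdm
    (Filter.Eventually.of_forall fun y => ENNReal.ofReal_lt_top), ← integral_neg]
  congr 1 with y
  simp only [hd, ENNReal.toReal_ofReal (h0 y), smul_eq_mul, Pi.neg_apply]
  ring

end Existence

/-! ### The sup bound for the potential of a density in `L¹ ∩ L^{5/3}`. -/

section PotentialBound

/-- Hölder with exponents `5/2` and `5/3` inside radius `R`, and `1/|z| ≤ 1/R` outside. The `5/2`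
power of `|z|^{-1}` is locally integrable, with integral `8π R^{1/2}` over the ball. -/
lemma rieszPotential_one_le_split {ρ : R3 → ℝ} (hρ : AEStronglyMeasurable ρ volume) {R : ℝ}
    (hR : 0 < R) (x : R3) :
    rieszPotential 1 ρ x ≤ ENNReal.ofReal ((8 * Real.pi) ^ (2 / 5 : ℝ) * R ^ (1 / 5 : ℝ))
        * eLpNorm ρ (5 / 3) volume + ENNReal.ofReal R⁻¹ * eLpNorm ρ 1 volume := by
  set k : R3 → ℝ≥0∞ := fun y => (Metric.ball 0 R).indicator (rieszKernel 1) (x - y) with hk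
  have hkm : Measurable k := ((measurable_rieszKernel 1).indicator measurableSet_ball).comp
    (measurable_const.sub measurable_id)
  have hconj : (5 / 2 : ℝ).HolderConjugate (5 / 3) := by
    rw [Real.holderConjugate_iff]; norm_num
  have hhol := ENNReal.lintegral_mul_le_Lp_mul_Lq volume hconj hkm.aemeasurable hρ.enorm
  have e1 : ∫⁻ y, k y ^ (5 / 2 : ℝ) = ENNReal.ofReal (8 * Real.pi * R ^ (1 / 2 : ℝ)) := by
    have e : ∀ y, k y ^ (5 / 2 : ℝ)
        = (Metric.ball 0 R).indicator (rieszKernel (5 / 2)) (x - y) := fun y => by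
      by_cases hy : x - y ∈ Metric.ball (0 : R3) R
      · simp only [hk, Set.indicator_of_mem hy]
        rw [rieszKernel_rpow (by norm_num), one_mul]
      · simp only [hk, Set.indicator_of_notMem hy]
        exact ENNReal.zero_rpow_of_pos (by norm_num)
    simp_rw [e]
    rw [lintegral_indicator_rieszKernel_sub (by norm_num) hR]
    norm_num
    ring_nf
  have e2 : (∫⁻ y, ‖ρ y‖ₑ ^ (5 / 3 : ℝ)) ^ (1 / (5 / 3) : ℝ) = eLpNorm ρ (5 / 3) volume := by
    have h53 : (5 / 3 : ℝ≥0∞).toReal = 5 / 3 := by simp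
    rw [eLpNorm_eq_lintegral_rpow_enorm_toReal (by norm_num)
      (ENNReal.div_ne_top (by norm_num) (by norm_num)), h53]
  calc rieszPotential 1 ρ x
      ≤ ∫⁻ y, (k y * ‖ρ y‖ₑ + ENNReal.ofReal R⁻¹ * ‖ρ y‖ₑ) := by
        refine lintegral_mono fun y => ?_
        rw [← add_mul]
        gcongr
        have h := rieszKernel_le_indicator_add zero_le_one hR (x - y)
        rwa [Real.rpow_neg_one] at h
    _ = (∫⁻ y, k y * ‖ρ y‖ₑ) + ENNReal.ofReal R⁻¹ * eLpNorm ρ 1 volume := by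
        have hm : AEMeasurable (fun y => k y * ‖ρ y‖ₑ) volume := hkm.aemeasurable.mul hρ.enorm
        rw [lintegral_add_left' hm,
          lintegral_const_mul' _ _ ENNReal.ofReal_ne_top, eLpNorm_one_eq_lintegral_enorm]
    _ ≤ _ := by
        refine add_le_add (hhol.trans (le_of_eq ?_)) le_rfl
        rw [e1, e2, ENNReal.ofReal_rpow_of_nonneg (by positivity) (by norm_num),
          Real.mul_rpow (by positivity) (by positivity), ← Real.rpow_mul hR.le]
        norm_num

/-- The interpolation bound for the Newton potential of a density in `L¹ ∩ L^{5/3}`. -/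
theorem abs_newtonPotential_le {ρ : R3 → ℝ} (h1 : MemLp ρ 1 volume)
    (h53 : MemLp ρ (5 / 3) volume) (x : R3) :
    |newtonPotential ρ x| ≤ ((8 * Real.pi) ^ (2 / 5 : ℝ) + 1) *
      ((eLpNorm ρ 1 volume).toReal ^ (1 / 6 : ℝ) *
        (eLpNorm ρ (5 / 3) volume).toReal ^ (5 / 6 : ℝ)) := by
  set a := (eLpNorm ρ 1 volume).toReal with ha
  set b := (eLpNorm ρ (5 / 3) volume).toReal with hb
  have ha' : eLpNorm ρ 1 volume = ENNReal.ofReal a := (ENNReal.ofReal_toReal h1.2.ne).symm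
  have hb' : eLpNorm ρ (5 / 3) volume = ENNReal.ofReal b :=
    (ENNReal.ofReal_toReal h53.2.ne).symm
  have ha0 : 0 ≤ a := ENNReal.toReal_nonneg
  have hb0 : 0 ≤ b := ENNReal.toReal_nonneg
  have hzero : ρ =ᵐ[volume] 0 → newtonPotential ρ x = 0 := fun h => by
    rw [newtonPotential_apply]
    refine integral_eq_zero_of_ae ?_
    filter_upwards [h] with y hy
    simp [hy]
  rcases ha0.eq_or_lt with ha0 | ha0
  · rw [hzero ((eLpNorm_eq_zero_iff h1.1 one_ne_zero).mp (by rw [ha', ← ha0, ENNReal.ofReal_zero]))]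
    rw [abs_zero]
    positivity
  rcases hb0.eq_or_lt with hb0 | hb0
  · rw [hzero ((eLpNorm_eq_zero_iff h53.1 (p := 5 / 3)
      (ENNReal.div_pos (by norm_num) (by norm_num)).ne').mp
      (by rw [hb', ← hb0, ENNReal.ofReal_zero]))]
    rw [abs_zero]
    positivity
  -- This radius balances the two parts: `R^{1/5} b = R⁻¹ a = a^{1/6} b^{5/6}`. It requires `a, b >
  -- 0`; otherwise `ρ` vanishes a.e.
  set R : ℝ := (a / b) ^ (5 / 6 : ℝ) with hR
  have hR0 : 0 < R := by positivity
  have e1 : R ^ (1 / 5 : ℝ) * b = a ^ (1 / 6 : ℝ) * b ^ (5 / 6 : ℝ) := by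
    rw [hR, ← Real.rpow_mul (by positivity), Real.div_rpow ha0.le hb0.le, div_mul_eq_mul_div,
      mul_div_assoc]
    norm_num only
    congr 1
    rw [div_eq_iff (by positivity), ← Real.rpow_add hb0]
    norm_num
  have e2 : R⁻¹ * a = a ^ (1 / 6 : ℝ) * b ^ (5 / 6 : ℝ) := by
    rw [hR, Real.div_rpow ha0.le hb0.le, inv_div, div_mul_eq_mul_div, div_eq_iff (by positivity),
      mul_right_comm, ← Real.rpow_add ha0]
    norm_num
    ring
  have h := (enorm_newtonPotential_le (f := ρ) x).trans (rieszPotential_one_le_split h1.1 hR0 x)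
  rw [ha', hb', ← ENNReal.ofReal_mul (by positivity), ← ENNReal.ofReal_mul (by positivity),
    ← ENNReal.ofReal_add (by positivity) (by positivity), ← ofReal_norm,
    ENNReal.ofReal_le_ofReal_iff (by positivity), mul_assoc, e1, e2, Real.norm_eq_abs] at h
  linarith

end PotentialBound

/-! ### Assembly of the proposition. -/

lemma SolvesPoisson.congr_ae {U f f' : R3 → ℝ} (h : SolvesPoisson U f) (hff' : f =ᵐ[volume] f') :
    SolvesPoisson U f' := by
  refine ⟨h.1, h.2.1.congr hff', fun φ hφ hc => ?_⟩
  rw [h.2.2 φ hφ hc]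
  refine integral_congr_ae ?_
  filter_upwards [hff'] with x hx
  rw [hx]

theorem proposition2p6 :
    ∃ (C : ℝ) (K : ℝ≥0 → ℝ), 0 < C ∧ (∀ α, 0 < K α) ∧
      ∀ (g : R3 → ℝ), MemLp g 1 volume → MemLp g ∞ volume → (∀ᵐ x : R3, 0 ≤ g x) →
      ∀ (ρ : R3 → ℝ), MemLp ρ 1 volume → MemLp ρ (5 / 3) volume →
        ∃ U : R3 → ℝ,
          SolvesPoisson U (fun x => g x * Real.exp (newtonPotential ρ x + U x)) ∧
          ContDiff ℝ 1 U ∧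
          weakLpNorm 3 U ≤ ENNReal.ofReal
            (C * (eLpNorm g 1 volume).toReal *
              Real.exp (C * ((eLpNorm ρ 1 volume).toReal ^ (1 / 6 : ℝ) *
                (eLpNorm ρ (5 / 3) volume).toReal ^ (5 / 6 : ℝ)))) ∧
          weakLpNorm (3 / 2) (∇ U) ≤ ENNReal.ofReal
            (C * (eLpNorm g 1 volume).toReal *
              Real.exp (C * ((eLpNorm ρ 1 volume).toReal ^ (1 / 6 : ℝ) *
                (eLpNorm ρ (5 / 3) volume).toReal ^ (5 / 6 : ℝ)))) ∧
          ∀ α : ℝ≥0, 0 < α → α < 1 →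
            c1HolderNorm α U ≤ ENNReal.ofReal
              (K α * ((eLpNorm g 1 volume).toReal + (eLpNorm g ∞ volume).toReal) *
                Real.exp (C * ((eLpNorm ρ 1 volume).toReal ^ (1 / 6 : ℝ) *
                  (eLpNorm ρ (5 / 3) volume).toReal ^ (5 / 6 : ℝ)))) := by
  set C₀ : ℝ := (8 * Real.pi) ^ (2 / 5 : ℝ) + 1 with hC₀
  have hC₀0 : 0 < C₀ := by positivity
  -- One `C` serves as prefactor and in the exponent: it dominates the weak-type constants `2π + 1`
  -- and `4π + 1` as well as `C₀`. The absolute value keeps `K α` positive also for `α ≥ 1`, where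
  -- nothing is claimed.
  refine ⟨4 * Real.pi + 1 + C₀, fun α => 8 * Real.pi * |1 - (α : ℝ)|⁻¹ + 6 * Real.pi + 4,
    by positivity, fun α => by positivity, fun g hg1 hgi hg0 ρ hρ1 hρ53 => ?_⟩
  set C : ℝ := 4 * Real.pi + 1 + C₀ with hC
  set q : ℝ := (eLpNorm ρ 1 volume).toReal ^ (1 / 6 : ℝ) *
    (eLpNorm ρ (5 / 3) volume).toReal ^ (5 / 6 : ℝ) with hq
  have hq0 : 0 ≤ q := by positivity
  set V := newtonPotential ρ with hV
  have hVq : ∀ x, V x ≤ C₀ * q := fun x => (le_abs_self _).trans (abs_newtonPotential_le hρ1 hρ53 x)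
  have hVm : Measurable V := (stronglyMeasurable_newtonPotential hρ1.1).measurable
  -- a nonnegative Borel representative of `g`
  set g₀ : R3 → ℝ := fun x => max (hg1.1.mk g x) 0 with hg₀
  have hg₀m : Measurable g₀ := hg1.1.stronglyMeasurable_mk.measurable.max measurable_const
  have hg₀0 : ∀ x, 0 ≤ g₀ x := fun x => le_max_right _ _
  have hgg₀ : g =ᵐ[volume] g₀ := by
    filter_upwards [hg1.1.ae_eq_mk, hg0] with x hx hx0
    exact (max_eq_left hx0).symm.trans (congrArg (max · 0) hx)
  set h : R3 → ℝ := fun x => g₀ x * Real.exp (V x) with hh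
  have hhm : Measurable h := hg₀m.mul hVm.exp
  have hh0 : ∀ x, 0 ≤ h x := fun x => mul_nonneg (hg₀0 x) (Real.exp_pos _).le
  have hhg : ∀ᵐ x, ‖h x‖ ≤ Real.exp (C₀ * q) * ‖g x‖ := by
    filter_upwards [hgg₀] with x hx
    rw [hh, hx, norm_mul, mul_comm, Real.norm_of_nonneg (Real.exp_pos _).le]
    gcongr
    exact hVq x
  obtain ⟨U, hUm, hU0, hU⟩ := exists_eq_newtonPotential_neg_mul_exp hhm hh0
    (hg1.of_le_mul hhm.aestronglyMeasurable hhg) (hgi.of_le_mul hhm.aestronglyMeasurable hhg)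
  set f : R3 → ℝ := fun x => h x * Real.exp (U x) with hf
  have hfm : Measurable f := hhm.mul hUm.measurable.exp
  -- The sign of `U` enters here: `e^U ≤ 1`, so `f` obeys the same bound as `h`.
  have hfg : ∀ᵐ x, ‖f x‖ ≤ Real.exp (C₀ * q) * ‖g x‖ := by
    filter_upwards [hhg] with x hx
    refine le_trans ?_ hx
    rw [hf, norm_mul]
    refine mul_le_of_le_one_right (norm_nonneg _) ?_
    rw [Real.norm_of_nonneg (Real.exp_pos _).le]
    exact Real.exp_le_one_iff.mpr (hU0 x)
  have hf1 : MemLp f 1 volume := hg1.of_le_mul hfm.aestronglyMeasurable hfg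
  have hfi : MemLp f ⊤ volume := hgi.of_le_mul hfm.aestronglyMeasurable hfg
  have hexp : Real.exp (C₀ * q) ≤ Real.exp (C * q) := by
    gcongr
    linarith [Real.pi_pos]
  have hnorm : ∀ p : ℝ≥0∞, MemLp g p volume →
      (eLpNorm (-f) p volume).toReal ≤ (eLpNorm g p volume).toReal * Real.exp (C * q) := by
    intro p hgp
    have h2 := eLpNorm_le_mul_eLpNorm_of_ae_le_mul hfg p
    rw [eLpNorm_neg]
    refine (ENNReal.toReal_mono (ENNReal.mul_ne_top ENNReal.ofReal_ne_top hgp.2.ne) h2).trans ?_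
    rw [ENNReal.toReal_mul, ENNReal.toReal_ofReal (Real.exp_pos _).le, mul_comm]
    gcongr
  have hweak : ∀ c : ℝ, 0 ≤ c → c ≤ C → ENNReal.ofReal c * eLpNorm (-f) 1 volume
      ≤ ENNReal.ofReal (C * (eLpNorm g 1 volume).toReal * Real.exp (C * q)) := by
    intro c hc0 hcC
    rw [← ENNReal.ofReal_toReal hf1.neg.2.ne, ← ENNReal.ofReal_mul hc0, mul_assoc]
    refine ENNReal.ofReal_le_ofReal ?_
    gcongr
    exact hnorm 1 hg1
  refine ⟨U, ?_, ?_, ?_, ?_, fun α hα0 hα1 => ?_⟩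
  · have hsol := solvesPoisson_newtonPotential_neg hf1 hfi
    rw [← hU] at hsol
    refine hsol.congr_ae ?_
    filter_upwards [hgg₀] with x hx
    simp only [hf, hh, hx, Real.exp_add, mul_assoc, hV]
  · rw [hU]
    exact contDiff_newtonPotential hf1.neg hfi.neg
  · rw [hU]
    refine (weakLpNorm_le_of_le_rieszPotential one_pos (by norm_num) (by norm_num) hf1.neg.1
      enorm_newtonPotential_le).trans (hweak _ (by norm_num; positivity) ?_)
    rw [hC]
    linarith [Real.pi_pos]
  · rw [hU, gradient_newtonPotential hf1.neg hfi.neg]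
    refine (weakLpNorm_le_of_le_rieszPotential two_pos (by norm_num) (by norm_num) hf1.neg.1
      enorm_gradNewtonPotential_le).trans (hweak _ (by norm_num; positivity) ?_)
    rw [hC]
    linarith [Real.pi_pos]
  · rw [hU]
    refine (c1HolderNorm_newtonPotential_le hf1.neg hfi.neg hα1).trans
      (ENNReal.ofReal_le_ofReal ?_)
    have hα1' : (0 : ℝ) < 1 - α := sub_pos.mpr (by exact_mod_cast hα1)
    beta_reduce
    rw [abs_of_pos hα1', ← div_eq_mul_inv, mul_assoc]
    gcongr
    rw [l1AddLinfty, add_mul]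
    exact add_le_add (hnorm 1 hg1) (hnorm ⊤ hgi)
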